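/- Let $G$ be a locally compact second countable Hausdorff group and let $\mathcal H_R\neq 0$ and $\mathcal H_S$ be separable complex Hilbert spaces carrying strongly continuous (possibly projective) unitary representations $U_R$, $U_S$ of $G$. Let $R$ be a principal quantum reference frame, i.e. a positive operator-valued measure $\mathsf E:\mathcal B(G)\to B(\mathcal H_R)$ with $\mathsf E(gX)=U_R(g)\mathsf E(X)U_R(g)^*$ for all $g\in G$ and Borel $X\subseteq G$. For $A\in B(\mathcal H_S)$ let $$¥^R(A)=\int_G d\mathsf E(g)\otimes U_S(g)AU_S(g)^*\in B(\mathcal H_R\otimes\mathcal H_S)$$ in the weak sense: $¥^R(A)$ is the unique bounded operator with $$\langle \xi\otimes\eta,\,¥^R(A)(\xi\otimes\eta')\rangle=\int_G\langle\eta,U_S(g)AU_S(g)^*\eta'\rangle\,d\mu_\xi(g),\qquad \mu_\xi(X)=\langle\xi,\mathsf E(X)\xi\rangle,$$ for all $\xi\in\mathcal H_R$, $\eta,\eta'\in\mathcal H_S$. Let $B(\mathcal H_S)^R$ be the ultraweak closure of the linear span of $\{¥^R(F): 0\le F\le 1\}$. Assume that $R$ is localizable: whenever $\mathsf E(X)\ne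 0$ and $\varepsilon>0$ there is a unit vector $\xi\in\mathcal H_R$ with $\langle\xi,\mathsf E(X)\xi\rangle>1-\varepsilon$. Then: 1. The operators $¥^R(A)$ exist and are unique, and $¥^R$ is an isometric linear bijection from $B(\mathcal H_S)$ onto $B(\mathcal H_S)^R$ (in particular its image is already ultraweakly closed). 2. With its own norm, linear structure and adjoint, and with the transported product $¥^R(A)\cdot ¥^R(B):=¥^R(AB)$, the space $B(\mathcal H_S)^R$ is an (abstract) von Neumann algebra, i.e. a C*-algebra that has a Banach space predual, and $¥^R:B(\mathcal H_S)\to B(\mathcal H_S)^R$ is an isometric $*$-isomorphism. 3. If moreover $R$ is sharp, i.e. every $\mathsf E(X)$ is an orthogonal projection, then $¥^R(AB)=¥^R(A)¥^R(B)$ for all $A,B\in B(\mathcal H_S)$, and $B(\mathcal H_S)^R$ is a von Neumann subalgebra of the von Neumann algebra $B(\mathcal H_R\otimes\mathcal H_S)^G$ of operators $T$ with $(U_R(g)\otimes U_S(g))\,T\,(U_R(g)\otimes U_S(g))^*=T$ for all $g\in G$, itself a von Neumann subalgebra of $B(\mathcal H_R\otimes\mathcal H_S)$. -/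

import Mathlib

open MeasureTheory Filter Topology
open scoped TensorProduct InnerProductSpace

/-! ### Composite systems -/

/-- The Hilbert space tensor product of two Hilbert spaces: the completion of the algebraic tensor
product for the inner product with `⟪ξ ⊗ η, ξ' ⊗ η'⟫ = ⟪ξ, ξ'⟫ * ⟪η, η'⟫`. -/
def HilbertTensor (H K : Type*) [NormedAddCommGroup H] [InnerProductSpace ℂ H]
    [NormedAddCommGroup K] [InnerProductSpace ℂ K] : Type _ :=
  UniformSpace.Completion (H ⊗[ℂ] K)

namespace HilbertTensor

variable {H K : Type*} [NormedAddCommGroup H] [InnerProductSpace ℂ H]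
  [NormedAddCommGroup K] [InnerProductSpace ℂ K]

noncomputable instance instNormedAddCommGroup : NormedAddCommGroup (HilbertTensor H K) :=
  inferInstanceAs (NormedAddCommGroup (UniformSpace.Completion (H ⊗[ℂ] K)))

noncomputable instance instInnerProductSpace : InnerProductSpace ℂ (HilbertTensor H K) :=
  inferInstanceAs (InnerProductSpace ℂ (UniformSpace.Completion (H ⊗[ℂ] K)))

instance instCompleteSpace : CompleteSpace (HilbertTensor H K) :=
  inferInstanceAs (CompleteSpace (UniformSpace.Completion (H ⊗[ℂ] K)))

/-- The inclusion of the algebraic tensor product. -/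
noncomputable def incl (t : H ⊗[ℂ] K) : HilbertTensor H K :=
  (t : UniformSpace.Completion (H ⊗[ℂ] K))

theorem denseRange_incl : DenseRange (incl : H ⊗[ℂ] K → HilbertTensor H K) :=
  UniformSpace.Completion.denseRange_coe

theorem inner_incl (s t : H ⊗[ℂ] K) : ⟪incl s, incl t⟫_ℂ = ⟪s, t⟫_ℂ :=
  UniformSpace.Completion.inner_coe s t

end HilbertTensor

/-- The elementary tensor `ξ ⊗ η` as a vector of the Hilbert space tensor product. -/
noncomputable def pureTensor {H K : Type*} [NormedAddCommGroup H] [InnerProductSpace ℂ H]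
    [NormedAddCommGroup K] [InnerProductSpace ℂ K] (ξ : H) (η : K) : HilbertTensor H K :=
  HilbertTensor.incl (ξ ⊗ₜ[ℂ] η)

/-- The operator `A ⊗ B` on the Hilbert space tensor product. -/
noncomputable def tensorOp {H K : Type*} [NormedAddCommGroup H] [InnerProductSpace ℂ H]
    [NormedAddCommGroup K] [InnerProductSpace ℂ K] (A : H →L[ℂ] H) (B : K →L[ℂ] K) :
    HilbertTensor H K →L[ℂ] HilbertTensor H K :=
  (TensorProduct.mapL A B).completion

section TensorLemmas

variable {H K : Type*} [NormedAddCommGroup H] [InnerProductSpace ℂ H]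
  [NormedAddCommGroup K] [InnerProductSpace ℂ K]

theorem tensorOp_incl (A : H →L[ℂ] H) (B : K →L[ℂ] K) (t : H ⊗[ℂ] K) :
    tensorOp A B (HilbertTensor.incl t) = HilbertTensor.incl (TensorProduct.mapL A B t) :=
  ContinuousLinearMap.completion_apply_coe (TensorProduct.mapL A B) t

theorem HilbertTensor.ext_op {S T : HilbertTensor H K →L[ℂ] HilbertTensor H K}
    (h : ∀ t : H ⊗[ℂ] K, S (HilbertTensor.incl t) = T (HilbertTensor.incl t)) : S = T :=
  DFunLike.coe_injective
    (HilbertTensor.denseRange_incl.equalizer S.continuous T.continuous (funext h))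

theorem tensorOp_mul (A A' : H →L[ℂ] H) (B B' : K →L[ℂ] K) :
    tensorOp (A * A') (B * B') = tensorOp A B * tensorOp A' B' :=
  HilbertTensor.ext_op fun t => by
    simp only [tensorOp_incl, mul_apply_eq_comp, TensorProduct.mapL_mul]

theorem tensorOp_one : tensorOp (1 : H →L[ℂ] H) (1 : K →L[ℂ] K) = 1 :=
  HilbertTensor.ext_op fun t => by
    rw [tensorOp_incl]
    simp [ContinuousLinearMap.one_def]

theorem inner_mapL_star [CompleteSpace H] [CompleteSpace K] (A : H →L[ℂ] H) (B : K →L[ℂ] K)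
    (s t : H ⊗[ℂ] K) :
    ⟪TensorProduct.mapL (star A) (star B) s, t⟫_ℂ = ⟪s, TensorProduct.mapL A B t⟫_ℂ := by
  induction s using TensorProduct.induction_on with
  | zero => simp
  | add x y hx hy => rw [map_add, inner_add_left, inner_add_left, hx, hy]
  | tmul a b =>
    induction t using TensorProduct.induction_on with
    | zero => simp
    | add x y hx hy => rw [map_add, inner_add_right, inner_add_right, hx, hy]
    | tmul c d =>
      rw [TensorProduct.mapL_tmul, TensorProduct.mapL_tmul, TensorProduct.inner_tmul,
        TensorProduct.inner_tmul, ContinuousLinearMap.star_eq_adjoint,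
        ContinuousLinearMap.star_eq_adjoint, ContinuousLinearMap.adjoint_inner_left,
        ContinuousLinearMap.adjoint_inner_left]

theorem tensorOp_star [CompleteSpace H] [CompleteSpace K] (A : H →L[ℂ] H) (B : K →L[ℂ] K) :
    tensorOp (star A) (star B) = star (tensorOp A B) := by
  rw [ContinuousLinearMap.star_eq_adjoint (tensorOp A B), ContinuousLinearMap.eq_adjoint_iff]
  intro s t
  induction s using HilbertTensor.denseRange_incl.induction_on with
  | hp => exact isClosed_eq (by fun_prop) (by fun_prop)
  | ih s =>
    induction t using HilbertTensor.denseRange_incl.induction_on with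
    | hp => exact isClosed_eq (by fun_prop) (by fun_prop)
    | ih t =>
      rw [tensorOp_incl, tensorOp_incl, HilbertTensor.inner_incl, HilbertTensor.inner_incl,
        inner_mapL_star]

end TensorLemmas

/-! ### The ultraweak topology -/

section Ultraweak

variable (H : Type*) [NormedAddCommGroup H] [InnerProductSpace ℂ H]

/-- Pairs of square-summable sequences of vectors. They parametrize (redundantly) the trace-class
operators, through `Ω = ∑ₙ |yₙ⟩⟨xₙ|`. -/
abbrev SqSummablePair : Type _ :=
  {p : (ℕ → H) × (ℕ → H) // (Summable fun n => ‖p.1 n‖ ^ 2) ∧ Summable fun n => ‖p.2 n‖ ^ 2}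

variable {H}

theorem SqSummablePair.summable_inner (p : SqSummablePair H) (A : H →L[ℂ] H) :
    Summable fun n => ⟪p.1.1 n, A (p.1.2 n)⟫_ℂ := by
  refine Summable.of_norm_bounded (g := fun n => ‖A‖ * (‖p.1.1 n‖ ^ 2 + ‖p.1.2 n‖ ^ 2))
    ((p.2.1.add p.2.2).mul_left _) fun n => ?_
  have h1 := norm_inner_le_norm (𝕜 := ℂ) (p.1.1 n) (A (p.1.2 n))
  have h2 := A.le_opNorm (p.1.2 n)
  have h3 : ‖p.1.1 n‖ * ‖A (p.1.2 n)‖ ≤ ‖p.1.1 n‖ * (‖A‖ * ‖p.1.2 n‖) :=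
    mul_le_mul_of_nonneg_left h2 (norm_nonneg _)
  nlinarith [norm_nonneg A, mul_nonneg (norm_nonneg A) (sq_nonneg (‖p.1.1 n‖ - ‖p.1.2 n‖)),
    mul_nonneg (norm_nonneg A) (sq_nonneg (‖p.1.1 n‖)),
    mul_nonneg (norm_nonneg A) (sq_nonneg (‖p.1.2 n‖))]

/-- The map sending an operator `A` to the family of its expectation values
`tr (Ω A) = ∑ₙ ⟪xₙ, A yₙ⟫` in all trace-class operators `Ω = ∑ₙ |yₙ⟩⟨xₙ|`. -/
noncomputable def expectations (H : Type*) [NormedAddCommGroup H] [InnerProductSpace ℂ H] :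
    (H →L[ℂ] H) →ₗ[ℂ] (SqSummablePair H → ℂ) where
  toFun A p := ∑' n, ⟪p.1.1 n, A (p.1.2 n)⟫_ℂ
  map_add' A B := by
    funext p
    simp only [add_apply, inner_add_right, Pi.add_apply]
    exact (p.summable_inner A).tsum_add (p.summable_inner B)
  map_smul' c A := by
    funext p
    simp only [smul_apply, inner_smul_right, Pi.smul_apply, RingHom.id_apply,
      smul_eq_mul]
    exact tsum_mul_left

/-- The ultraweak topology on the bounded operators: pointwise convergence of the expectation values
in all trace-class operators. -/
@[reducible]
noncomputable def ultraweakTopology (H : Type*) [NormedAddCommGroup H] [InnerProductSpace ℂ H] :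
    TopologicalSpace (H →L[ℂ] H) :=
  TopologicalSpace.induced (expectations H) inferInstance

/-- The ultraweak closure of a linear space of operators. -/
noncomputable def ultraweakClosure (V : Submodule ℂ (H →L[ℂ] H)) : Submodule ℂ (H →L[ℂ] H) where
  carrier := @closure _ (ultraweakTopology H) V
  zero_mem' := @subset_closure _ (ultraweakTopology H) _ _ V.zero_mem
  add_mem' := by
    let := ultraweakTopology H
    have : IsTopologicalAddGroup (H →L[ℂ] H) := topologicalAddGroup_induced (expectations H)
    intro a b ha hb
    exact V.toAddSubmonoid.topologicalClosure.add_mem ha hb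
  smul_mem' := by
    let := ultraweakTopology H
    have : ContinuousConstSMul ℂ (H →L[ℂ] H) :=
      ⟨fun c => continuous_induced_rng.2 (by
        have : (expectations H ∘ fun x : H →L[ℂ] H => c • x) = fun x => c • expectations H x := by
          funext x; simp
        rw [this]
        exact (continuous_induced_dom (f := expectations H)).const_smul c)⟩
    intro c a ha
    exact map_mem_closure (continuous_const_smul c) ha fun x hx => V.smul_mem c hx

end Ultraweak

/-! ### Observables and frames -/

/-- A positive operator-valued measure on the measurable space `S`. (Only the values on measurable
sets matter.) -/
structure POVM (S : Type*) [MeasurableSpace S] (H : Type*) [NormedAddCommGroup H]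
    [InnerProductSpace ℂ H] [CompleteSpace H] where
  /-- The effect attached to a measurable set. -/
  effect : Set S → H →L[ℂ] H
  isPositive : ∀ X, MeasurableSet X → (effect X).IsPositive
  effect_univ : effect Set.univ = 1
  hasSum_iUnion : ∀ X : ℕ → Set S, (∀ n, MeasurableSet (X n)) →
    Pairwise (Function.onFun Disjoint X) →
    ∀ ξ : H, HasSum (fun n => ⟪ξ, effect (X n) ξ⟫_ℂ) ⟪ξ, effect (⋃ n, X n) ξ⟫_ℂ

namespace POVM

variable {S : Type*} [MeasurableSpace S] {H : Type*} [NormedAddCommGroup H]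
  [InnerProductSpace ℂ H] [CompleteSpace H]

theorem hasSum_re (E : POVM S H) (ξ : H) {X : ℕ → Set S} (hX : ∀ n, MeasurableSet (X n))
    (hd : Pairwise (Function.onFun Disjoint X)) :
    HasSum (fun n => (⟪ξ, E.effect (X n) ξ⟫_ℂ).re) (⟪ξ, E.effect (⋃ n, X n) ξ⟫_ℂ).re :=
  Complex.hasSum_re (E.hasSum_iUnion X hX hd ξ)

theorem re_nonneg (E : POVM S H) (ξ : H) {X : Set S} (hX : MeasurableSet X) :
    0 ≤ (⟪ξ, E.effect X ξ⟫_ℂ).re :=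
  (E.isPositive X hX).re_inner_nonneg_right ξ

theorem re_empty (E : POVM S H) (ξ : H) : (⟪ξ, E.effect ∅ ξ⟫_ℂ).re = 0 := by
  have h := E.hasSum_re ξ (X := fun _ => ∅) (fun _ => MeasurableSet.empty)
    (fun _ _ _ => disjoint_bot_left)
  exact (summable_const_iff _).1 h.summable

/-- The (Born) measure `X ↦ ⟪ξ, E(X) ξ⟫` of the observable in the vector `ξ`; a probability measure
when `ξ` is a unit vector. -/
noncomputable def bornMeasure (E : POVM S H) (ξ : H) : Measure S :=
  Measure.ofMeasurable (fun X _ => ENNReal.ofReal (⟪ξ, E.effect X ξ⟫_ℂ).re)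
    (by simp [E.re_empty ξ])
    (fun X hX hd => by
      have h := E.hasSum_re ξ hX hd
      change ENNReal.ofReal _ = _
      rw [← h.tsum_eq, ENNReal.ofReal_tsum_of_nonneg (fun n => E.re_nonneg ξ (hX n)) h.summable])

theorem bornMeasure_apply (E : POVM S H) (ξ : H) {X : Set S} (hX : MeasurableSet X) :
    E.bornMeasure ξ X = ENNReal.ofReal (⟪ξ, E.effect X ξ⟫_ℂ).re :=
  Measure.ofMeasurable_apply X hX

/-- Localizability (the `ε`-decidability property). -/
def IsLocalizable (E : POVM S H) : Prop :=
  ∀ X, MeasurableSet X → E.effect X ≠ 0 → ∀ ε : ℝ, 0 < ε →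
    ∃ ξ : H, ‖ξ‖ = 1 ∧ 1 - ε < (⟪ξ, E.effect X ξ⟫_ℂ).re

/-- Sharpness: all effects are (orthogonal) projections. -/
def IsSharp (E : POVM S H) : Prop :=
  ∀ X, MeasurableSet X → IsStarProjection (E.effect X)

end POVM

/-- A strongly continuous projective unitary representation: unitaries `U g`, multiplicative up to
phases, such that the induced homomorphism to the unitary group modulo phases is continuous for the
strong operator topology. Strongly continuous unitary representations are those for which all the
phases can be taken to be `1`. -/
structure ProjUnitaryRep (G : Type*) [Group G] [TopologicalSpace G] (H : Type*)
    [NormedAddCommGroup H] [InnerProductSpace ℂ H] [CompleteSpace H] where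
  /-- The operators of the representation. -/
  op : G → H →L[ℂ] H
  mem_unitary : ∀ g, op g ∈ unitary (H →L[ℂ] H)
  op_mul : ∀ g h, ∃ c : ℂ, ‖c‖ = 1 ∧ op (g * h) = c • (op g * op h)
  continuous_mod_phase : ∀ g₀, ∃ c : G → ℂ, (∀ g, ‖c g‖ = 1) ∧
    ∀ ξ : H, Tendsto (fun g => c g • op g ξ) (𝓝 g₀) (𝓝 (op g₀ ξ))

/-- A principal quantum reference frame: a covariant POVM on the group `G`, on which `G` acts by left
translations. -/
structure PrincipalFrame (G : Type*) [Group G] [TopologicalSpace G] [MeasurableSpace G] (H : Type*)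
    [NormedAddCommGroup H] [InnerProductSpace ℂ H] [CompleteSpace H] where
  /-- The representation of the group on the Hilbert space of the frame. -/
  rep : ProjUnitaryRep G H
  /-- The frame-orientation observable. -/
  obs : POVM G H
  covariant : ∀ (g : G) (X : Set G), MeasurableSet X →
    obs.effect ((fun x => g * x) '' X) = rep.op g * obs.effect X * star (rep.op g)

/-! ### Invariant operators -/

section Invariant

variable {G : Type*} [Group G] [TopologicalSpace G]
  {H K : Type*} [NormedAddCommGroup H] [InnerProductSpace ℂ H] [CompleteSpace H]
  [NormedAddCommGroup K] [InnerProductSpace ℂ K] [CompleteSpace K]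

/-- The von Neumann algebra `B(H ⊗ K)^G` of operators invariant under the diagonal action, as the
commutant of the operators `U(g) ⊗ V(g)` and their adjoints; see `mem_invariantAlgebra`. -/
noncomputable def invariantAlgebra (U : ProjUnitaryRep G H) (V : ProjUnitaryRep G K) :
    VonNeumannAlgebra (HilbertTensor H K) where
  toStarSubalgebra := StarSubalgebra.centralizer ℂ (Set.range fun g => tensorOp (U.op g) (V.op g))
  centralizer_centralizer' := by
    change Set.centralizer (Set.centralizer
      (StarSubalgebra.centralizer ℂ (Set.range fun g => tensorOp (U.op g) (V.op g)) :
        Set (HilbertTensor H K →L[ℂ] HilbertTensor H K))) =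
      (StarSubalgebra.centralizer ℂ (Set.range fun g => tensorOp (U.op g) (V.op g)) :
        Set (HilbertTensor H K →L[ℂ] HilbertTensor H K))
    rw [StarSubalgebra.coe_centralizer, Set.centralizer_centralizer_centralizer]

theorem mem_invariantAlgebra (U : ProjUnitaryRep G H) (V : ProjUnitaryRep G K)
    (T : HilbertTensor H K →L[ℂ] HilbertTensor H K) :
    T ∈ invariantAlgebra U V ↔
      ∀ g, tensorOp (U.op g) (V.op g) * T * star (tensorOp (U.op g) (V.op g)) = T := by
  have h1 : ∀ g, star (tensorOp (U.op g) (V.op g)) * tensorOp (U.op g) (V.op g) = 1 := fun g => by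
    rw [← tensorOp_star, ← tensorOp_mul, (Unitary.mem_iff.1 (U.mem_unitary g)).1,
      (Unitary.mem_iff.1 (V.mem_unitary g)).1, tensorOp_one]
  have h2 : ∀ g, tensorOp (U.op g) (V.op g) * star (tensorOp (U.op g) (V.op g)) = 1 := fun g => by
    rw [← tensorOp_star, ← tensorOp_mul, (Unitary.mem_iff.1 (U.mem_unitary g)).2,
      (Unitary.mem_iff.1 (V.mem_unitary g)).2, tensorOp_one]
  have h0 : T ∈ invariantAlgebra U V ↔
      T ∈ StarSubalgebra.centralizer ℂ (Set.range fun g => tensorOp (U.op g) (V.op g)) := Iff.rfl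
  rw [h0, StarSubalgebra.mem_centralizer_iff]
  constructor
  · intro h g
    rw [(h _ ⟨g, rfl⟩).1, mul_assoc, h2, mul_one]
  · rintro h _ ⟨g, rfl⟩
    have h3 := h g
    constructor
    · change tensorOp (U.op g) (V.op g) * T = T * tensorOp (U.op g) (V.op g)
      conv_rhs => rw [← h3]
      rw [mul_assoc _ (star _) _, h1, mul_one]
    · change star (tensorOp (U.op g) (V.op g)) * T = T * star (tensorOp (U.op g) (V.op g))
      conv_lhs => rw [← h3]
      rw [← mul_assoc, ← mul_assoc, h1, one_mul]

end Invariant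

/-! ### Relativization -/

namespace PrincipalFrame

variable {G : Type*} [Group G] [TopologicalSpace G] [MeasurableSpace G]
  {HR HS : Type*} [NormedAddCommGroup HR] [InnerProductSpace ℂ HR] [CompleteSpace HR]
  [NormedAddCommGroup HS] [InnerProductSpace ℂ HS] [CompleteSpace HS]

/-- `T` is the weak operator integral `∫ dE(g) ⊗ U(g) A U(g)*`. By polarization in `ξ` the identity
fixes all the matrix elements of `T` between elementary tensors. -/
def IsWeakIntegral (R : PrincipalFrame G HR) (U : ProjUnitaryRep G HS) (A : HS →L[ℂ] HS)
    (T : HilbertTensor HR HS →L[ℂ] HilbertTensor HR HS) : Prop :=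
  ∀ (ξ : HR) (η η' : HS),
    ⟪pureTensor ξ η, T (pureTensor ξ η')⟫_ℂ =
      ∫ g, ⟪η, (U.op g * A * star (U.op g)) η'⟫_ℂ ∂(R.obs.bornMeasure ξ)

open Classical in
/-- The relativization map `A ↦ ∫ dE(g) ⊗ U(g) A U(g)*`. (Existence and
uniqueness of the weak integral are asserted along with the results about this map, so that the
default value plays no role.) -/
noncomputable def relativize (R : PrincipalFrame G HR) (U : ProjUnitaryRep G HS)
    (A : HS →L[ℂ] HS) : HilbertTensor HR HS →L[ℂ] HilbertTensor HR HS :=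
  if h : ∃ T, R.IsWeakIntegral U A T then h.choose else 0

/-- The space of relative operators: the ultraweak closure of the linear span of the relativized
effects. -/
noncomputable def relativeOperators (R : PrincipalFrame G HR) (U : ProjUnitaryRep G HS) :
    Submodule ℂ (HilbertTensor HR HS →L[ℂ] HilbertTensor HR HS) :=
  ultraweakClosure
    (Submodule.span ℂ (R.relativize U '' {F : HS →L[ℂ] HS | 0 ≤ F ∧ F ≤ 1}))

end PrincipalFrame

/-! ### Transport of a C*-algebra structure along a linear isometry -/

/-- The normed space `V` (with its own norm and linear structure), endowed with the product and the
involution transported from the C*-algebra `M` along the isometric linear isomorphism `e`. -/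
def Transported {M V : Type*} [CStarAlgebra M] [NormedAddCommGroup V] [NormedSpace ℂ V]
    (_e : M ≃ₗᵢ[ℂ] V) : Type _ := V

namespace Transported

variable {M V : Type*} [CStarAlgebra M] [NormedAddCommGroup V] [NormedSpace ℂ V] (e : M ≃ₗᵢ[ℂ] V)

/-- The identity map from the transported algebra to the underlying normed space. -/
def val {e : M ≃ₗᵢ[ℂ] V} (x : Transported e) : V := x

noncomputable instance instNormedAddCommGroup : NormedAddCommGroup (Transported e) :=
  inferInstanceAs (NormedAddCommGroup V)

noncomputable instance instNormedSpace : NormedSpace ℂ (Transported e) :=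
  inferInstanceAs (NormedSpace ℂ V)

/-- `e` as an isometric linear isomorphism onto the transported algebra. -/
noncomputable def equiv : M ≃ₗᵢ[ℂ] Transported e := e

noncomputable instance instNormedRing : NormedRing (Transported e) where
  __ := instNormedAddCommGroup e
  mul x y := equiv e ((equiv e).symm x * (equiv e).symm y)
  one := equiv e 1
  left_distrib x y z := by
    change equiv e ((equiv e).symm x * (equiv e).symm (y + z)) =
      equiv e ((equiv e).symm x * (equiv e).symm y) + equiv e ((equiv e).symm x * (equiv e).symm z)
    rw [map_add, mul_add, map_add]
  right_distrib x y z := by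
    change equiv e ((equiv e).symm (x + y) * (equiv e).symm z) =
      equiv e ((equiv e).symm x * (equiv e).symm z) + equiv e ((equiv e).symm y * (equiv e).symm z)
    rw [map_add, add_mul, map_add]
  zero_mul x := by
    change equiv e ((equiv e).symm 0 * (equiv e).symm x) = 0
    rw [map_zero, zero_mul, map_zero]
  mul_zero x := by
    change equiv e ((equiv e).symm x * (equiv e).symm 0) = 0
    rw [map_zero, mul_zero, map_zero]
  mul_assoc x y z := by
    change equiv e ((equiv e).symm (equiv e ((equiv e).symm x * (equiv e).symm y)) *
      (equiv e).symm z) = equiv e ((equiv e).symm x *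
      (equiv e).symm (equiv e ((equiv e).symm y * (equiv e).symm z)))
    simp only [LinearIsometryEquiv.symm_apply_apply, mul_assoc]
  one_mul x := by
    change equiv e ((equiv e).symm (equiv e 1) * (equiv e).symm x) = x
    simp
  mul_one x := by
    change equiv e ((equiv e).symm x * (equiv e).symm (equiv e 1)) = x
    simp
  norm_mul_le x y := by
    change ‖equiv e ((equiv e).symm x * (equiv e).symm y)‖ ≤ ‖x‖ * ‖y‖
    rw [LinearIsometryEquiv.norm_map]
    refine (norm_mul_le _ _).trans (le_of_eq ?_)
    rw [LinearIsometryEquiv.norm_map, LinearIsometryEquiv.norm_map]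
  dist_eq x y := (instNormedAddCommGroup e).dist_eq x y

theorem mul_def (x y : Transported e) :
    x * y = equiv e ((equiv e).symm x * (equiv e).symm y) := rfl

theorem norm_val (x : Transported e) : ‖x.val‖ = ‖x‖ := rfl

noncomputable instance instNormedAlgebra : NormedAlgebra ℂ (Transported e) where
  __ := Algebra.ofModule (R := ℂ) (A := Transported e)
    (fun c x y => by simp [mul_def]) (fun c x y => by simp [mul_def])
  norm_smul_le c x := (instNormedSpace e).norm_smul_le c x

noncomputable instance instStarRing : StarRing (Transported e) where
  star x := equiv e (star ((equiv e).symm x))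
  star_involutive x := by
    change equiv e (star ((equiv e).symm (equiv e (star ((equiv e).symm x))))) = x
    simp
  star_mul x y := by
    change equiv e (star ((equiv e).symm (x * y))) = equiv e (star ((equiv e).symm y)) *
      equiv e (star ((equiv e).symm x))
    simp [mul_def]
  star_add x y := by
    change equiv e (star ((equiv e).symm (x + y))) = equiv e (star ((equiv e).symm x)) +
      equiv e (star ((equiv e).symm y))
    rw [map_add, star_add, map_add]

theorem star_def (x : Transported e) : star x = equiv e (star ((equiv e).symm x)) := rfl

noncomputable instance instCStarAlgebra : CStarAlgebra (Transported e) where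
  complete := by
    have : CompleteSpace (Transported e) :=
      (completeSpace_congr (equiv e).toIsometryEquiv.isometry.isUniformInducing.isUniformEmbedding
        (e := (equiv e).toEquiv)).1 (inferInstance : CompleteSpace M)
    exact fun {f} hf => this.complete hf
  norm_mul_self_le x := by
    rw [mul_def, LinearIsometryEquiv.norm_map, star_def, LinearIsometryEquiv.symm_apply_apply,
      CStarRing.norm_star_mul_self, LinearIsometryEquiv.norm_map]
  star_smul c x := by
    rw [star_def, star_def, map_smul, star_smul, map_smul]

end Transported

/-! Existence comes from approximation. Let `γ n` be simple functions on `G` tending pointwise to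
the identity. The finite sums of `E(X) ⊗ U(g)AU(g)*` over their level sets are bounded by `‖A‖`:
factor each effect as `R*R` and use Cauchy-Schwarz (`norm_inner_simpleIntegral_le`). A weak limit
along an ultrafilter is the integral, by dominated convergence. Uniqueness is polarization.

Isometry comes from localizability. Countably many translates of an open neighbourhood of `1` cover
`G`, so by covariance its effect is nonzero (`effect_ne_zero_of_isOpen`). Hence there are unit
vectors `ξ` whose Born measure is nearly concentrated where `⟪η, U(g)AU(g)* η'⟫` is close to `⟪η,
Aη'⟫`, and the matrix elements of `A` are recovered from those of its relativization
(`norm_inner_le_norm_relativize`).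

That the range is closed is duality. Relativization is normal (`exists_normal_inner_relativize`):
its matrix elements are Bochner integrals in the predual of `B(HS)`. Let `Q` map `ℓ¹`, over pairs of
vectors in the unit ball, to that predual, sending a basis vector to the matrix element it labels.
The dual of `Q` is bounded below because relativization is isometric, so `Q` is onto. If `T` is
annihilated by every normal functional vanishing on the range, its matrix elements define a
functional on `ℓ¹` that kills the kernel of `Q`. It thus factors through `Q`, and the factor is an
operator `A` relativizing to `T` (`mem_range_of_annihilated`).

This criterion applies to the ultraweak closure and, for sharp frames, also to the bicommutant, by
the density argument in `annihilated_of_mem_bicommutant`. Sharpness gives `E(X)E(Y) = E(X ∩ Y)`, so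
products of approximating sums integrate products of functions, and iterated limits give
multiplicativity. -/

/-! ### Normal functionals and bounded forms. -/

section Predual

set_option maxSynthPendingDepth 3

variable {H : Type*} [NormedAddCommGroup H] [InnerProductSpace ℂ H]

/-- Continuous functionals on the closed span of a set are determined by their values on the set. -/
theorem closedSpan_dual_ext {W : Type*} [NormedAddCommGroup W] [NormedSpace ℂ W] {S : Set W}
    {F F' : StrongDual ℂ (Submodule.span ℂ S).topologicalClosure}
    (h : ∀ x (hx : x ∈ S), F ⟨x, Submodule.le_topologicalClosure _ (Submodule.subset_span hx)⟩ =
      F' ⟨x, Submodule.le_topologicalClosure _ (Submodule.subset_span hx)⟩) : F = F' := by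
  have hspan : ∀ ψ (hψ : ψ ∈ Submodule.span ℂ S),
      F ⟨ψ, Submodule.le_topologicalClosure _ hψ⟩ =
        F' ⟨ψ, Submodule.le_topologicalClosure _ hψ⟩ := by
    intro ψ hψ
    induction hψ using Submodule.span_induction with
    | mem ψ hψ => exact h ψ hψ
    | zero => exact (map_zero F).trans (map_zero F').symm
    | add a b ha hb ha' hb' =>
      have e : (⟨a + b, Submodule.le_topologicalClosure _ (add_mem ha hb)⟩ :
        (Submodule.span ℂ S).topologicalClosure) = ⟨a, Submodule.le_topologicalClosure _ ha⟩ +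
          ⟨b, Submodule.le_topologicalClosure _ hb⟩ := rfl
      rw [e, map_add, map_add, ha', hb']
    | smul c a ha ha' =>
      have e : (⟨c • a, Submodule.le_topologicalClosure _ (Submodule.smul_mem _ c ha)⟩ :
        (Submodule.span ℂ S).topologicalClosure) =
          c • ⟨a, Submodule.le_topologicalClosure _ ha⟩ := rfl
      rw [e, map_smul, map_smul, ha']
  ext ⟨φ, hφ⟩
  obtain ⟨u, hu, hlim⟩ := mem_closure_iff_seq_limit.1
    (show φ ∈ closure (Submodule.span ℂ S : Set W) from hφ)
  have hl : Tendsto (fun n => (⟨u n, Submodule.le_topologicalClosure _ (hu n)⟩ :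
      (Submodule.span ℂ S).topologicalClosure)) atTop (𝓝 ⟨φ, hφ⟩) :=
    tendsto_subtype_rng.2 hlim
  refine tendsto_nhds_unique ((F.continuous.tendsto _).comp hl) ?_
  exact ((F'.continuous.tendsto _).comp hl).congr fun n => (hspan (u n) (hu n)).symm

/-- The functional `A ↦ ⟪x, A y⟫` on the bounded operators. -/
noncomputable def vectorFunctional (x y : H) : StrongDual ℂ (H →L[ℂ] H) :=
  (innerSL ℂ x).comp (ContinuousLinearMap.apply ℂ H y)

@[simp]
theorem vectorFunctional_apply (x y : H) (A : H →L[ℂ] H) :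
    vectorFunctional x y A = ⟪x, A y⟫_ℂ := rfl

theorem norm_vectorFunctional_le (x y : H) : ‖vectorFunctional x y‖ ≤ ‖x‖ * ‖y‖ := by
  refine ContinuousLinearMap.opNorm_le_bound _ (by positivity) fun A => ?_
  calc ‖⟪x, A y⟫_ℂ‖ ≤ ‖x‖ * ‖A y‖ := norm_inner_le_norm _ _
    _ ≤ ‖x‖ * (‖A‖ * ‖y‖) := by gcongr; exact A.le_opNorm y
    _ = ‖x‖ * ‖y‖ * ‖A‖ := by ring

theorem continuous_vectorFunctional :
    Continuous fun p : H × H => vectorFunctional p.1 p.2 := by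
  unfold vectorFunctional
  fun_prop

variable (H) in
/-- The space of normal functionals on `B(H)`: the closed span of the vector functionals. -/
noncomputable def normalFunctionals : Submodule ℂ (StrongDual ℂ (H →L[ℂ] H)) :=
  (Submodule.span ℂ (Set.range fun p : H × H => vectorFunctional p.1 p.2)).topologicalClosure

theorem isClosed_normalFunctionals :
    IsClosed (normalFunctionals H : Set (StrongDual ℂ (H →L[ℂ] H))) :=
  Submodule.isClosed_topologicalClosure _

instance : CompleteSpace (normalFunctionals H) :=
  isClosed_normalFunctionals.completeSpace_coe

theorem vectorFunctional_mem (x y : H) : vectorFunctional x y ∈ normalFunctionals H :=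
  Submodule.le_topologicalClosure _ (Submodule.subset_span ⟨(x, y), rfl⟩)

/-- The vector functionals as elements of the predual. -/
noncomputable def vectorNormal (x y : H) : normalFunctionals H :=
  ⟨vectorFunctional x y, vectorFunctional_mem x y⟩

theorem normalFunctionals_dual_ext {F F' : StrongDual ℂ (normalFunctionals H)}
    (h : ∀ x y : H, F (vectorNormal x y) = F' (vectorNormal x y)) : F = F' := by
  refine closedSpan_dual_ext ?_
  rintro _ ⟨p, rfl⟩
  exact h p.1 p.2

/-- A bounded sesquilinear form is the form of a bounded operator. -/
theorem exists_operator_of_form {H : Type*} [NormedAddCommGroup H] [InnerProductSpace ℂ H]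
    [CompleteSpace H] (L : H → H → ℂ)
    (hadd : ∀ x x' y, L (x + x') y = L x y + L x' y)
    (hsmul : ∀ (c : ℂ) x y, L (c • x) y = (starRingEnd ℂ) c * L x y)
    (hadd' : ∀ x y y', L x (y + y') = L x y + L x y')
    (hsmul' : ∀ (c : ℂ) x y, L x (c • y) = c * L x y)
    (C : ℝ) (hC : 0 ≤ C) (hL : ∀ x y, ‖L x y‖ ≤ C * ‖x‖ * ‖y‖) :
    ∃ A : H →L[ℂ] H, ‖A‖ ≤ C ∧ ∀ x y, ⟪x, A y⟫_ℂ = L x y := by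
  let B : H →L⋆[ℂ] H →L[ℂ] ℂ := LinearMap.mkContinuous₂
    (LinearMap.mk₂'ₛₗ (starRingEnd ℂ) (RingHom.id ℂ) L hadd hsmul hadd' hsmul') C hL
  let A := InnerProductSpace.continuousLinearMapOfBilin B
  -- The representing operator of `continuousLinearMapOfBilin` acts in the left slot of the inner
  -- product, so the operator wanted is its adjoint.
  have hA : ∀ x y, ⟪x, (ContinuousLinearMap.adjoint A) y⟫_ℂ = L x y := fun x y => by
    rw [ContinuousLinearMap.adjoint_inner_right,
      InnerProductSpace.continuousLinearMapOfBilin_apply]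
    rfl
  refine ⟨ContinuousLinearMap.adjoint A, ?_, hA⟩
  refine ContinuousLinearMap.opNorm_le_bound _ hC fun y => ?_
  set v := (ContinuousLinearMap.adjoint A) y with hv
  have h1 : ‖v‖ * ‖v‖ ≤ C * ‖v‖ * ‖y‖ := by
    have := hL v y
    rwa [← hA, ← hv, norm_inner_symm, inner_self_eq_norm_sq_to_K, norm_pow,
      RCLike.norm_ofReal, abs_norm, sq] at this
  rcases (norm_nonneg v).eq_or_lt with h0 | h0
  · rw [← h0]; positivity
  · nlinarith

end Predual

/-! ### Surjectivity from a dual map that is bounded below. -/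

section ClosedRange

variable {X Y : Type*} [NormedAddCommGroup X] [NormedSpace ℂ X] [NormedAddCommGroup Y]
  [NormedSpace ℂ Y]

/-- If the dual map of `Q` is bounded below, then the image of the unit ball is dense in a ball. -/
theorem mem_closure_image_ball_of_norm_le_comp (Q : X →L[ℂ] Y)
    (hQ : ∀ f : StrongDual ℂ Y, ‖f‖ ≤ ‖f.comp Q‖) {y : Y} (hy : ‖y‖ ≤ 1) :
    y ∈ closure (Q '' Metric.closedBall 0 1) := by
  by_contra hn
  have hconv : Convex ℝ (closure (Q '' Metric.closedBall 0 1)) :=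
    ((convex_closedBall (0 : X) 1).is_linear_image
      ⟨fun a b => map_add Q a b, fun c a => Q.map_smul_of_tower c a⟩).closure
  obtain ⟨f, u, hf, hfy⟩ := RCLike.geometric_hahn_banach_closed_point (𝕜 := ℂ) hconv
    isClosed_closure hn
  have hu : 0 < u := by
    have := hf 0 (subset_closure ⟨0, by simp, map_zero Q⟩)
    simpa using this
  have hle : ‖f.comp Q‖ ≤ u := by
    refine ContinuousLinearMap.opNorm_le_of_unit_norm hu.le fun x hx => ?_
    -- Separation controls only the real part of `f`; rotating `x` by a phase turns it into a bound
    -- on the modulus.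
    obtain ⟨c, hc, hcx⟩ : ∃ c : ℂ, ‖c‖ = 1 ∧ c * f (Q x) = ‖f (Q x)‖ := by
      rcases eq_or_ne (f (Q x)) 0 with h0 | h0
      · exact ⟨1, by simp, by simp [h0]⟩
      · refine ⟨(‖f (Q x)‖ : ℂ) / f (Q x), ?_, ?_⟩
        · rw [norm_div, Complex.norm_real, norm_norm, div_self (norm_ne_zero_iff.2 h0)]
        · field_simp
    have h1 := hf (Q (c • x)) (subset_closure ⟨c • x, by simp [norm_smul, hc, hx], rfl⟩)
    rw [map_smul, map_smul, smul_eq_mul, hcx] at h1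
    simpa using h1.le
  have h2 : RCLike.re (f y) ≤ u := by
    calc RCLike.re (f y) ≤ ‖f y‖ := RCLike.re_le_norm _
      _ ≤ ‖f‖ * ‖y‖ := f.le_opNorm y
      _ ≤ u * 1 := mul_le_mul ((hQ f).trans hle) hy (norm_nonneg _) hu.le
      _ = u := mul_one u
  exact absurd hfy (not_lt.2 h2)

/-- One half of the closed range theorem: a bounded operator whose dual map is bounded below is
surjective. -/
theorem exists_preimage_of_norm_le_comp [CompleteSpace X] (Q : X →L[ℂ] Y)
    (hQ : ∀ f : StrongDual ℂ Y, ‖f‖ ≤ ‖f.comp Q‖) (y : Y) :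
    ∃ x, Q x = y ∧ ‖x‖ ≤ 2 * ‖y‖ := by
  -- Each approximate preimage halves the residual. The corrections then form a series dominated by
  -- a geometric one of sum `2‖y‖`, and completeness of `X` sums it.
  have step : ∀ y : Y, ∃ x, ‖x‖ ≤ ‖y‖ ∧ ‖y - Q x‖ ≤ ‖y‖ / 2 := by
    intro y
    rcases eq_or_ne y 0 with rfl | hy
    · exact ⟨0, by simp, by simp⟩
    have hy' : 0 < ‖y‖ := norm_pos_iff.2 hy
    have h1 := mem_closure_image_ball_of_norm_le_comp Q hQ (y := ((‖y‖⁻¹ : ℝ) : ℂ) • y)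
      (by rw [norm_smul, Complex.norm_real, norm_inv, norm_norm, inv_mul_cancel₀ hy'.ne'])
    obtain ⟨_, ⟨x, hx, rfl⟩, hd⟩ := Metric.mem_closure_iff.1 h1 (1 / 2) (by norm_num)
    have hx1 : ‖x‖ ≤ 1 := by simpa using hx
    refine ⟨(‖y‖ : ℂ) • x, ?_, ?_⟩
    · rw [norm_smul, Complex.norm_real, norm_norm]
      nlinarith
    · have e : y - Q ((‖y‖ : ℂ) • x) = (‖y‖ : ℂ) • (((‖y‖⁻¹ : ℝ) : ℂ) • y - Q x) := by
        rw [map_smul, smul_sub, smul_smul, Complex.ofReal_inv, mul_inv_cancel₀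
          (by exact_mod_cast hy'.ne'), one_smul]
      rw [e, norm_smul, Complex.norm_real, norm_norm, ← dist_eq_norm]
      nlinarith
  choose g hg1 hg2 using step
  let r : ℕ → Y := fun n => (fun y => y - Q (g y))^[n] y
  have hr0 : r 0 = y := rfl
  have hrs : ∀ n, r (n + 1) = r n - Q (g (r n)) := fun n => by
    simp only [r, Function.iterate_succ_apply']
  have hrn : ∀ n, ‖r n‖ ≤ ‖y‖ * (1 / 2) ^ n := by
    intro n
    induction n with
    | zero => simp [hr0]
    | succ n ih =>
      rw [hrs, pow_succ]
      have := hg2 (r n)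
      linarith
  have hsum : HasSum (fun n => ‖y‖ * (1 / 2 : ℝ) ^ n) (‖y‖ * 2) :=
    hasSum_geometric_two.mul_left _
  have hle : ∀ n, ‖g (r n)‖ ≤ ‖y‖ * (1 / 2) ^ n := fun n => (hg1 _).trans (hrn n)
  have hsg : Summable fun n => g (r n) := Summable.of_norm_bounded hsum.summable hle
  refine ⟨∑' n, g (r n), ?_, ?_⟩
  · have h1 : Tendsto (fun n => Q (∑ i ∈ Finset.range n, g (r i))) atTop
        (𝓝 (Q (∑' n, g (r n)))) :=
      (Q.continuous.tendsto _).comp hsg.hasSum.tendsto_sum_nat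
    have h2 : ∀ n, Q (∑ i ∈ Finset.range n, g (r i)) = y - r n := by
      intro n
      induction n with
      | zero => simp [hr0]
      | succ n ih => rw [Finset.sum_range_succ, map_add, ih, hrs]; abel
    have h3 : Tendsto r atTop (𝓝 0) := by
      rw [tendsto_zero_iff_norm_tendsto_zero]
      exact squeeze_zero (fun n => norm_nonneg _) hrn hsum.summable.tendsto_atTop_zero
    refine tendsto_nhds_unique h1 ?_
    simp only [h2]
    simpa using tendsto_const_nhds.sub h3
  · rw [mul_comm, ← hsum.tsum_eq]
    exact tsum_of_norm_bounded hsum hle |>.trans hsum.tsum_eq.ge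

/-- If the dual map of `Q` is bounded below, then every functional that vanishes on the kernel of
`Q` is in its range. -/
theorem exists_dual_comp_eq [CompleteSpace X] (Q : X →L[ℂ] Y)
    (hQ : ∀ f : StrongDual ℂ Y, ‖f‖ ≤ ‖f.comp Q‖) (g : StrongDual ℂ X)
    (hg : ∀ x, Q x = 0 → g x = 0) : ∃ f : StrongDual ℂ Y, ∀ x, f (Q x) = g x := by
  choose s hs1 hs2 using exists_preimage_of_norm_le_comp Q hQ
  -- The chosen section `s` need not be linear, but `g` is constant on the fibres of `Q`, so `g ∘ s`
  -- is linear.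
  have key : ∀ x x', Q x = Q x' → g x = g x' := fun x x' h => by
    rw [← sub_eq_zero, ← map_sub]
    exact hg _ (by rw [map_sub, h, sub_self])
  let f : Y →ₗ[ℂ] ℂ :=
    { toFun := fun y => g (s y)
      map_add' := fun y y' => by
        rw [← map_add]
        exact key _ _ (by rw [map_add, hs1, hs1, hs1])
      map_smul' := fun c y => by
        rw [RingHom.id_apply, ← map_smul]
        exact key _ _ (by rw [map_smul, hs1, hs1]) }
  refine ⟨f.mkContinuous (‖g‖ * 2) fun y => ?_, fun x => key _ _ (hs1 _)⟩
  calc ‖g (s y)‖ ≤ ‖g‖ * ‖s y‖ := g.le_opNorm _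
    _ ≤ ‖g‖ * (2 * ‖y‖) := by gcongr; exact hs2 y
    _ = ‖g‖ * 2 * ‖y‖ := by ring

end ClosedRange

/-! ### `B(H)` as the dual of the normal functionals. -/

section Predual

set_option maxSynthPendingDepth 3

universe u v

variable {H : Type u} [NormedAddCommGroup H] [InnerProductSpace ℂ H]

/-- Evaluation of the functionals in the predual at an operator. -/
noncomputable def predualEval (A : H →L[ℂ] H) : StrongDual ℂ (normalFunctionals H) :=
  (ContinuousLinearMap.apply ℂ ℂ A).comp (normalFunctionals H).subtypeL

@[simp]
theorem predualEval_apply (A : H →L[ℂ] H) (φ : normalFunctionals H) :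
    predualEval A φ = (φ : StrongDual ℂ (H →L[ℂ] H)) A := rfl

/-- For the lower bound, testing on the vector functional of `A y` and `y` gives `‖A y‖²`, and the
norm of that functional is at most `‖A y‖ ‖y‖`. -/
theorem norm_predualEval (A : H →L[ℂ] H) : ‖predualEval A‖ = ‖A‖ := by
  apply le_antisymm
  · refine ContinuousLinearMap.opNorm_le_bound _ (norm_nonneg _) fun φ => ?_
    rw [predualEval_apply, mul_comm]
    exact (φ : StrongDual ℂ (H →L[ℂ] H)).le_opNorm A
  · have hA : 0 ≤ ‖predualEval A‖ := ContinuousLinearMap.opNorm_nonneg _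
    refine ContinuousLinearMap.opNorm_le_bound A hA fun y => ?_
    have h1 : ‖A y‖ * ‖A y‖ ≤ ‖predualEval A‖ * (‖A y‖ * ‖y‖) := by
      calc ‖A y‖ * ‖A y‖ = ‖⟪A y, A y⟫_ℂ‖ := by
            rw [inner_self_eq_norm_sq_to_K, norm_pow, RCLike.norm_ofReal, abs_norm, sq]
        _ = ‖predualEval A (vectorNormal (A y) y)‖ := rfl
        _ ≤ ‖predualEval A‖ * ‖vectorNormal (A y) y‖ := ContinuousLinearMap.le_opNorm _ _
        _ ≤ _ := by gcongr; exact norm_vectorFunctional_le _ _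
    rcases (norm_nonneg (A y)).eq_or_lt with h0 | h0
    · rw [← h0]; positivity
    · nlinarith

theorem vectorNormal_add_left (x x' y : H) :
    vectorNormal (x + x') y = vectorNormal x y + vectorNormal x' y :=
  Subtype.ext (by ext A; exact inner_add_left _ _ _)

theorem vectorNormal_add_right (x y y' : H) :
    vectorNormal x (y + y') = vectorNormal x y + vectorNormal x y' :=
  Subtype.ext (by
    ext A
    change ⟪x, A (y + y')⟫_ℂ = ⟪x, A y⟫_ℂ + ⟪x, A y'⟫_ℂ
    rw [map_add, inner_add_right])

theorem vectorNormal_smul_left (c : ℂ) (x y : H) :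
    vectorNormal (c • x) y = (starRingEnd ℂ) c • vectorNormal x y :=
  Subtype.ext (by ext A; exact inner_smul_left _ _ _)

theorem vectorNormal_smul_right (c : ℂ) (x y : H) :
    vectorNormal x (c • y) = c • vectorNormal x y :=
  Subtype.ext (by
    ext A
    change ⟪x, A (c • y)⟫_ℂ = c • ⟪x, A y⟫_ℂ
    rw [map_smul, inner_smul_right, smul_eq_mul])

/-- The values of `F` on vector functionals form a bounded sesquilinear form, hence come from an
operator; vector functionals are total, so this determines `F`. -/
theorem predualEval_surjective [CompleteSpace H] :
    Function.Surjective (predualEval : (H →L[ℂ] H) → StrongDual ℂ (normalFunctionals H)) := by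
  intro F
  obtain ⟨A, -, hA⟩ := exists_operator_of_form (fun x y : H => F (vectorNormal x y))
    (fun x x' y => by rw [vectorNormal_add_left, map_add])
    (fun c x y => by rw [vectorNormal_smul_left, map_smul, smul_eq_mul])
    (fun x y y' => by rw [vectorNormal_add_right, map_add])
    (fun c x y => by rw [vectorNormal_smul_right, map_smul, smul_eq_mul])
    ‖F‖ (norm_nonneg _) (fun x y => by
      calc ‖F (vectorNormal x y)‖ ≤ ‖F‖ * ‖vectorNormal x y‖ := F.le_opNorm _
        _ ≤ ‖F‖ * (‖x‖ * ‖y‖) := by gcongr; exact norm_vectorFunctional_le _ _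
        _ = ‖F‖ * ‖x‖ * ‖y‖ := by ring)
  exact ⟨A, normalFunctionals_dual_ext fun x y => hA x y⟩

/-- A C*-algebra that is isometrically isomorphic to `B(H)` as a Banach space has a predual. -/
theorem wStarAlgebra_of_linearIsometryEquiv [CompleteSpace H] {M : Type (max u v)}
    [CStarAlgebra M] (e : (H →L[ℂ] H) ≃ₗᵢ[ℂ] M) : WStarAlgebra M := by
  -- The predual has to live in the universe of `M`.
  let i : ULift.{v} (normalFunctionals H) ≃ₗᵢ[ℂ] normalFunctionals H :=
    LinearIsometryEquiv.ulift _ _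
  let ev : (H →L[ℂ] H) →ₗᵢ[ℂ] StrongDual ℂ (ULift.{v} (normalFunctionals H)) :=
    { toFun := fun A => (predualEval A).comp (i : ULift.{v} (normalFunctionals H) →L[ℂ] _)
      map_add' := fun A B => by ext φ; exact map_add (i φ).1 A B
      map_smul' := fun c A => by ext φ; exact map_smul (i φ).1 c A
      norm_map' := fun A => by
        rw [← norm_predualEval A]
        exact ContinuousLinearMap.opNorm_comp_linearIsometryEquiv _ i }
  have hev : Function.Surjective ev := fun F => by
    obtain ⟨A, hA⟩ := predualEval_surjective 
      (F.comp (i.symm : normalFunctionals H →L[ℂ] ULift.{v} (normalFunctionals H)))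
    refine ⟨A, ?_⟩
    ext φ
    exact congrArg (fun F => F (i φ)) hA
  have : CompleteSpace (ULift.{v} (normalFunctionals H)) :=
    (completeSpace_congr i.toIsometryEquiv.isometry.isUniformInducing.isUniformEmbedding
      (e := i.toEquiv)).2 inferInstance
  -- The identification with the dual must be conjugate linear, so the linear one is composed with
  -- the involution of `M`.
  exact ⟨⟨ULift.{v} (normalFunctionals H), inferInstance, inferInstance, this,
    ⟨(LinearIsometryEquiv.ofSurjective ev hev).symm.trans (e.trans (starₗᵢ ℂ))⟩⟩⟩

end Predual

/-! ### Ranges of normal isometries. -/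

section NormalRange

set_option maxSynthPendingDepth 3

/-- A bounded family in a Banach space defines a bounded operator on `ℓ¹`. -/
theorem exists_lsum {ι W : Type*} [NormedAddCommGroup W] [NormedSpace ℂ W] [CompleteSpace W]
    [DecidableEq ι] (D : ι → W) {C : ℝ} (hD : ∀ i, ‖D i‖ ≤ C) :
    ∃ Q : lp (fun _ : ι => ℂ) 1 →L[ℂ] W, (∀ c : lp (fun _ : ι => ℂ) 1,
      HasSum (fun i => c i • D i) (Q c)) ∧ ∀ i, Q (lp.single 1 i 1) = D i := by
  have hs : ∀ c : lp (fun _ : ι => ℂ) 1, HasSum (fun i => ‖c i‖) ‖c‖ := fun c => by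
    simpa using lp.hasSum_norm (p := 1) (by simp) c
  have hle : ∀ (c : lp (fun _ : ι => ℂ) 1) (i : ι), ‖c i • D i‖ ≤ C * ‖c i‖ := fun c i => by
    rw [norm_smul, mul_comm]
    gcongr
    exact hD i
  have hsum : ∀ c : lp (fun _ : ι => ℂ) 1, Summable fun i => c i • D i := fun c =>
    Summable.of_norm_bounded ((hs c).summable.mul_left C) (hle c)
  let Q : lp (fun _ : ι => ℂ) 1 →ₗ[ℂ] W :=
    { toFun := fun c => ∑' i, c i • D i
      map_add' := fun c c' => by
        rw [← (hsum c).tsum_add (hsum c')]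
        exact tsum_congr fun i => add_smul _ _ _
      map_smul' := fun a c => by
        rw [RingHom.id_apply, ← (hsum c).tsum_const_smul a]
        exact tsum_congr fun i => mul_smul _ _ _ }
  refine ⟨Q.mkContinuous C fun c => ?_, fun c => (hsum c).hasSum, fun i => ?_⟩
  · exact tsum_of_norm_bounded ((hs c).mul_left C) (hle c)
  · change ∑' j, (lp.single 1 i (1 : ℂ) : lp (fun _ : ι => ℂ) 1) j • D j = D i
    rw [tsum_eq_single i (fun j hj => by simp [hj])]
    simp

/-- Absolutely summable combinations of vector functionals are given by square summable
sequences. -/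
theorem exists_sqSummablePair {L ι : Type*} [NormedAddCommGroup L] [InnerProductSpace ℂ L]
    (c : ι → ℂ) (hc : Summable fun i => ‖c i‖) (x y : ι → L) (hx : ∀ i, ‖x i‖ ≤ 1)
    (hy : ∀ i, ‖y i‖ ≤ 1) :
    ∃ p : SqSummablePair L, ∀ A : L →L[ℂ] L, expectations L A p = ∑' i, c i * ⟪x i, A (y i)⟫_ℂ := by
  -- The index set is arbitrary, but summable coefficients have countable support. It embeds in `ℕ`,
  -- and the sequences are extended by zero off its image.
  have hcount : Countable (Function.support c) := by
    have := hc.countable_support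
    rwa [show Function.support (fun i => ‖c i‖) = Function.support c by ext; simp] at this
  obtain ⟨e, he⟩ := exists_injective_nat (Function.support c)
  -- Splitting `c` as `s * (c / s)` with `|s|² = |c|` makes both weighted sequences of vectors
  -- square summable; on the support of `c` the division is legitimate.
  let s : ι → ℂ := fun i => ((√‖c i‖ : ℝ) : ℂ)
  have hs : ∀ i, ‖s i‖ ^ 2 = ‖c i‖ := fun i => by
    simp only [s, Complex.norm_real, Real.norm_eq_abs, sq_abs]
    exact Real.sq_sqrt (norm_nonneg _)
  let u : Function.support c → L := fun i => s i • x i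
  let w : Function.support c → L := fun i => (c i / s i) • y i
  have hcs : ∀ i : Function.support c, s i ≠ 0 := fun i => by
    intro h
    have := hs i
    rw [h, norm_zero, sq, mul_zero] at this
    exact norm_ne_zero_iff.2 i.2 this.symm
  have hu : ∀ i : Function.support c, ‖u i‖ ^ 2 ≤ ‖c i‖ := fun i => by
    rw [norm_smul, mul_pow, hs]
    exact mul_le_of_le_one_right (norm_nonneg _) (pow_le_one₀ (norm_nonneg _) (hx _))
  have hw : ∀ i : Function.support c, ‖w i‖ ^ 2 ≤ ‖c i‖ := fun i => by
    have h0 : ‖c i‖ ≠ 0 := norm_ne_zero_iff.2 i.2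
    rw [norm_smul, mul_pow, norm_div, div_pow, hs, sq, mul_div_assoc, div_self h0, mul_one]
    exact mul_le_of_le_one_right (norm_nonneg _) (pow_le_one₀ (norm_nonneg _) (hy _))
  have hsum : ∀ v : Function.support c → L, (∀ i, ‖v i‖ ^ 2 ≤ ‖c i‖) →
      Summable fun n => ‖Function.extend e v 0 n‖ ^ 2 := fun v hv => by
    rw [← he.summable_iff (fun n hn => by
      rw [Function.extend_apply' _ _ _ (fun h => hn h)]; simp)]
    refine Summable.of_nonneg_of_le (fun i => sq_nonneg _) (fun i => ?_)
      (hc.comp_injective Subtype.val_injective)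
    simpa [he.extend_apply] using hv i
  refine ⟨⟨(Function.extend e u 0, Function.extend e w 0), hsum u hu, hsum w hw⟩, fun A => ?_⟩
  change ∑' n, ⟪Function.extend e u 0 n, A (Function.extend e w 0 n)⟫_ℂ = _
  rw [← he.tsum_eq (fun n hn => by
    by_contra h
    exact hn (by simp only [Function.extend_apply' _ _ _ (fun h' => h h'), Pi.zero_apply,
      inner_zero_left])),
    ← (Subtype.val_injective (p := (· ∈ Function.support c))).tsum_eq
      (f := fun i => c i * ⟪x i, A (y i)⟫_ℂ) (fun i hi => by
        rw [Subtype.range_coe]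
        exact fun h => hi (by simp [h]))]
  refine tsum_congr fun i => ?_
  rw [he.extend_apply, he.extend_apply]
  simp only [u, w, map_smul, inner_smul_left, inner_smul_right, s, Complex.conj_ofReal]
  have := hcs i
  simp only [s] at this
  field_simp

variable {K L : Type*} [NormedAddCommGroup K] [InnerProductSpace ℂ K] [CompleteSpace K]
  [NormedAddCommGroup L] [InnerProductSpace ℂ L]

/-- The range of an isometric normal linear map between the algebras of bounded operators contains
every operator that is annihilated by the normal functionals that vanish on the range. -/
theorem mem_range_of_annihilated (Y : (K →L[ℂ] K) →ₗ[ℂ] (L →L[ℂ] L)) (hY : ∀ A, ‖Y A‖ = ‖A‖)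
    (hnormal : ∀ x y : L, ∃ φ ∈ normalFunctionals K, ∀ A, φ A = ⟪x, Y A y⟫_ℂ)
    (T : L →L[ℂ] L)
    (hT : ∀ p : SqSummablePair L, (∀ A, expectations L (Y A) p = 0) → expectations L T p = 0) :
    ∃ A, Y A = T := by
  choose φ hφ hφY using hnormal
  let ι := Metric.closedBall (0 : L) 1 × Metric.closedBall (0 : L) 1
  have h1 : ∀ i : ι, ‖(i.1 : L)‖ ≤ 1 := fun i => mem_closedBall_zero_iff.1 i.1.2
  have h2 : ∀ i : ι, ‖(i.2 : L)‖ ≤ 1 := fun i => mem_closedBall_zero_iff.1 i.2.2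
  have hb : ∀ (S : L →L[ℂ] L) (x y : L), ‖x‖ ≤ 1 → ‖y‖ ≤ 1 → ‖⟪x, S y⟫_ℂ‖ ≤ ‖S‖ := by
    intro S x y hx hy
    calc ‖⟪x, S y⟫_ℂ‖ ≤ ‖x‖ * ‖S y‖ := norm_inner_le_norm _ _
      _ ≤ 1 * (‖S‖ * 1) := by
        gcongr
        exact (S.le_opNorm y).trans (by gcongr)
      _ = ‖S‖ := by ring
  let D : ι → normalFunctionals K := fun i => ⟨φ i.1 i.2, hφ _ _⟩
  have hD : ∀ i, ‖D i‖ ≤ 1 := fun i => by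
    refine ContinuousLinearMap.opNorm_le_bound _ zero_le_one fun A => ?_
    change ‖φ i.1 i.2 A‖ ≤ _
    rw [hφY, one_mul, ← hY A]
    exact hb _ _ _ (h1 i) (h2 i)
  classical
  -- `Q` plays the role of the pre-adjoint of `Y`, with `ℓ¹` standing in for the normal functionals
  -- on `B(L)`; `g` below records the matrix elements of `T`.
  obtain ⟨Q, hQ, hQs⟩ := exists_lsum D hD
  obtain ⟨g, hg, hgs⟩ := exists_lsum (fun i : ι => ⟪(i.1 : L), T i.2⟫_ℂ) 
    fun i => hb _ _ _ (h1 i) (h2 i)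
  have hiso : ∀ f : StrongDual ℂ (normalFunctionals K), ‖f‖ ≤ ‖f.comp Q‖ := by
    intro f
    obtain ⟨A, rfl⟩ := predualEval_surjective f
    rw [norm_predualEval, ← hY A]
    have hn : 0 ≤ ‖(predualEval A).comp Q‖ := ContinuousLinearMap.opNorm_nonneg _
    refine ContinuousLinearMap.opNorm_le_of_unit_norm hn fun y hy => ?_
    rcases eq_or_ne (Y A y) 0 with h0 | h0
    · rw [h0, norm_zero]; exact hn
    let x : L := ((‖Y A y‖⁻¹ : ℝ) : ℂ) • Y A y
    have hx : ‖x‖ = 1 := by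
      rw [norm_smul, Complex.norm_real, norm_inv, norm_norm,
        inv_mul_cancel₀ (norm_ne_zero_iff.2 h0)]
    -- At the basis vector labelled by the normalization of `Y A y` together with `y`, the
    -- functional takes the value `‖Y A y‖`.
    let i : ι := (⟨x, by simp [hx]⟩, ⟨y, by simp [hy]⟩)
    have e : ((predualEval A).comp Q) (lp.single 1 i (1 : ℂ)) = ‖Y A y‖ := by
      change predualEval A (Q _) = _
      rw [hQs]
      change φ x y A = _
      rw [hφY, inner_smul_left, Complex.conj_ofReal, inner_self_eq_norm_sq_to_K]
      have : (‖Y A y‖ : ℂ) ≠ 0 := by exact_mod_cast norm_ne_zero_iff.2 h0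
      push_cast
      simp only [Complex.coe_algebraMap]
      field_simp
    have h3 := ((predualEval A).comp Q).le_opNorm (lp.single 1 i (1 : ℂ))
    rw [e, lp.norm_single (by simp), norm_one, mul_one, Complex.norm_real, norm_norm] at h3
    exact h3
  -- A `c` in the kernel of `Q` is a normal functional on `B(L)` that vanishes on the range of `Y`;
  -- by hypothesis it annihilates `T`, that is, `g c = 0`.
  obtain ⟨f, hf⟩ := exists_dual_comp_eq Q hiso g fun c hc => by
    have hsc : Summable fun i => ‖c i‖ := by
      simpa using (lp.hasSum_norm (p := 1) (by simp) c).summable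
    obtain ⟨p, hp⟩ := exists_sqSummablePair c hsc (fun i => (i.1 : L)) (fun i => (i.2 : L)) h1 h2
    rw [← (hg c).tsum_eq]
    simp only [smul_eq_mul]
    rw [← hp]
    refine hT p fun A => ?_
    rw [hp]
    have h4 := (hQ c).map (predualEval A) (predualEval A).continuous
    rw [hc, map_zero] at h4
    rw [← h4.tsum_eq]
    refine tsum_congr fun i => ?_
    change _ = predualEval A (c i • D i)
    rw [map_smul, smul_eq_mul, predualEval_apply, hφY]
  obtain ⟨A, rfl⟩ := predualEval_surjective f
  refine ⟨A, ?_⟩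
  have hunit : ∀ x y : L, ‖x‖ ≤ 1 → ‖y‖ ≤ 1 → ⟪x, Y A y⟫_ℂ = ⟪x, T y⟫_ℂ := by
    intro x y hx hy
    let i : ι := (⟨x, by simpa using hx⟩, ⟨y, by simpa using hy⟩)
    have h5 := hf (lp.single 1 i (1 : ℂ))
    rw [hQs, hgs] at h5
    rw [← hφY]
    exact h5
  refine ContinuousLinearMap.ext fun y => ext_inner_left ℂ fun x => ?_
  have hsc : ∀ v : L, ∃ (v' : L) (r : ℝ), ‖v'‖ ≤ 1 ∧ v = (r : ℂ) • v' := by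
    intro v
    rcases eq_or_ne v 0 with rfl | hv
    · exact ⟨0, 0, by simp, by simp⟩
    have : (‖v‖ : ℂ) ≠ 0 := by exact_mod_cast norm_ne_zero_iff.2 hv
    refine ⟨((‖v‖⁻¹ : ℝ) : ℂ) • v, ‖v‖, ?_, ?_⟩
    · rw [norm_smul, Complex.norm_real, norm_inv, norm_norm,
        inv_mul_cancel₀ (norm_ne_zero_iff.2 hv)]
    · rw [smul_smul, Complex.ofReal_inv, mul_inv_cancel₀ this, one_smul]
  obtain ⟨x', r, hx', rfl⟩ := hsc x
  obtain ⟨y', t, hy', rfl⟩ := hsc y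
  simp only [map_smul, inner_smul_left, inner_smul_right, hunit x' y' hx' hy']

/-- Each expectation functional is ultraweakly continuous, so its kernel is closed. -/
theorem annihilated_of_mem_ultraweakClosure {V : Submodule ℂ (L →L[ℂ] L)} {T : L →L[ℂ] L}
    (hT : T ∈ ultraweakClosure V) (p : SqSummablePair L)
    (hp : ∀ S ∈ V, expectations L S p = 0) : expectations L T p = 0 := by
  let := ultraweakTopology L
  have hcont : Continuous fun S : L →L[ℂ] L => expectations L S p :=
    (continuous_apply p).comp continuous_induced_dom
  have hcl : IsClosed {S : L →L[ℂ] L | expectations L S p = 0} :=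
    isClosed_eq hcont continuous_const
  exact closure_minimal (fun S hS => hp S hS) hcl hT

end NormalRange

/-! ### Amplification and the bicommutant. -/

section Bicommutant

variable {L : Type*} [NormedAddCommGroup L]

theorem memlp_two_iff {x : ℕ → L} : Memℓp x 2 ↔ Summable fun n => ‖x n‖ ^ 2 := by
  rw [memℓp_gen_iff (by simp)]
  simp

variable [InnerProductSpace ℂ L]

/-- The amplification `A ⊕ A ⊕ ⋯` of a bounded operator. -/
noncomputable def amplify (A : L →L[ℂ] L) :
    lp (fun _ : ℕ => L) 2 →L[ℂ] lp (fun _ : ℕ => L) 2 :=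
  LinearMap.mkContinuous
    { toFun := fun x => ⟨fun n => A (x n), memlp_two_iff.2 <| by
        refine Summable.of_nonneg_of_le (fun n => by positivity) (fun n => ?_)
          ((memlp_two_iff.1 (lp.memℓp x)).mul_left (‖A‖ ^ 2))
        rw [← mul_pow]
        gcongr
        exact A.le_opNorm _⟩
      map_add' := fun x y => by ext n; exact map_add A _ _
      map_smul' := fun c x => by ext n; exact map_smul A _ _ } ‖A‖ fun x => by
    refine lp.norm_le_of_tsum_le (p := 2) (by simp) (by positivity) ?_
    have hx := lp.hasSum_norm (p := 2) (by simp) x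
    simp only [ENNReal.toReal_ofNat, Real.rpow_ofNat] at hx ⊢
    rw [mul_pow, ← (hx.mul_left (‖A‖ ^ 2)).tsum_eq]
    have hle : ∀ n, ‖A (x n)‖ ^ 2 ≤ ‖A‖ ^ 2 * ‖x n‖ ^ 2 := fun n => by
      rw [← mul_pow]
      gcongr
      exact A.le_opNorm _
    exact Summable.tsum_le_tsum hle (Summable.of_nonneg_of_le (fun n => by positivity) hle
      (hx.mul_left (‖A‖ ^ 2)).summable) (hx.mul_left (‖A‖ ^ 2)).summable

@[simp]
theorem amplify_apply (A : L →L[ℂ] L) (x : lp (fun _ : ℕ => L) 2) (n : ℕ) :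
    amplify A x n = A (x n) := rfl

theorem inner_amplify (A : L →L[ℂ] L) (x y : lp (fun _ : ℕ => L) 2) :
    ⟪x, amplify A y⟫_ℂ = ∑' n, ⟪x n, A (y n)⟫_ℂ := lp.inner_eq_tsum _ _

theorem amplify_single (A : L →L[ℂ] L) (j : ℕ) (a : L) :
    amplify A (lp.single 2 j a) = lp.single 2 j (A a) := by
  ext n
  by_cases h : n = j
  · subst h; simp
  · simp [h]

variable [CompleteSpace L]

theorem inner_amplify_star (A : L →L[ℂ] L) (x y : lp (fun _ : ℕ => L) 2) :
    ⟪amplify (star A) x, y⟫_ℂ = ⟪x, amplify A y⟫_ℂ := by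
  rw [lp.inner_eq_tsum, lp.inner_eq_tsum]
  refine tsum_congr fun n => ?_
  rw [amplify_apply, amplify_apply, ContinuousLinearMap.star_eq_adjoint,
    ContinuousLinearMap.adjoint_inner_left]

/-- The density part of the bicommutant theorem: a normal functional that vanishes on a unital
*-algebra vanishes on its bicommutant. -/
theorem annihilated_of_mem_bicommutant (M : StarSubalgebra ℂ (L →L[ℂ] L)) {T : L →L[ℂ] L}
    (hT : T ∈ Set.centralizer (Set.centralizer (M : Set (L →L[ℂ] L))))
    (p : SqSummablePair L) (hp : ∀ S ∈ M, expectations L S p = 0) : expectations L T p = 0 := by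
  let x : lp (fun _ : ℕ => L) 2 := ⟨p.1.1, memlp_two_iff.2 p.2.1⟩
  let y : lp (fun _ : ℕ => L) 2 := ⟨p.1.2, memlp_two_iff.2 p.2.2⟩
  have hxy : ∀ S, expectations L S p = ⟪x, amplify S y⟫_ℂ := fun S => (inner_amplify S x y).symm
  -- A normal functional is one matrix element of the amplification. It therefore suffices that the
  -- amplified `T` maps `y` into the closure of the orbit of `y` under `M`.
  let V₀ : Submodule ℂ (lp (fun _ : ℕ => L) 2) :=
    { carrier := {v | ∃ S ∈ M, amplify S y = v}
      zero_mem' := ⟨0, zero_mem M, by ext n; simp⟩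
      add_mem' := by
        rintro _ _ ⟨S, hS, rfl⟩ ⟨S', hS', rfl⟩
        exact ⟨S + S', add_mem hS hS', by ext n; simp⟩
      smul_mem' := by
        rintro c _ ⟨S, hS, rfl⟩
        exact ⟨c • S, M.smul_mem hS c, by ext n; simp⟩ }
  let V := V₀.topologicalClosure
  have : CompleteSpace V := V₀.isClosed_topologicalClosure.completeSpace_coe
  have hyV : y ∈ V := V₀.le_topologicalClosure ⟨1, one_mem M, by ext n; simp⟩
  have hinv : ∀ S ∈ M, ∀ v ∈ V, amplify S v ∈ V := by
    intro S hS v hv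
    refine map_mem_closure (amplify S).continuous hv ?_
    rintro _ ⟨S', hS', rfl⟩
    exact ⟨S * S', mul_mem hS hS', by ext n; simp⟩
  -- `V` is invariant under `M`, which is closed under adjoints, so its orthogonal complement is
  -- invariant too.
  have hcomm : ∀ S ∈ M, ∀ v, V.starProjection (amplify S v) = amplify S (V.starProjection v) := by
    intro S hS v
    refine Submodule.eq_starProjection_of_mem_of_inner_eq_zero
      (hinv S hS _ (Submodule.starProjection_apply_mem _ _)) (fun w hw => ?_)
    rw [← map_sub, inner_eq_zero_symm, ← inner_amplify_star, inner_eq_zero_symm]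
    exact Submodule.starProjection_inner_eq_zero _ _ (hinv _ (star_mem hS) _ hw)
  -- The matrix entries of the projection lie in the commutant of `M`, so `T` commutes with each of
  -- them, and its amplification with the projection.
  let Pij : ℕ → ℕ → L →L[ℂ] L := fun i j =>
    LinearMap.mkContinuous
      { toFun := fun a => V.starProjection (lp.single 2 j a) i
        map_add' := fun a b => by rw [lp.single_add, map_add]; rfl
        map_smul' := fun c a => by rw [lp.single_smul, map_smul]; rfl } 1 fun a => by
      rw [one_mul]
      refine (lp.norm_apply_le_norm (by simp) _ _).trans ?_
      refine (V.norm_starProjection_apply_le _).trans ?_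
      rw [lp.norm_single (by simp)]
  have hPij : ∀ i j, T * Pij i j = Pij i j * T := by
    intro i j
    refine (Set.mem_centralizer_iff.1 hT (Pij i j) (Set.mem_centralizer_iff.2 fun S hS => ?_)).symm
    ext a
    have := congrArg (fun v => v i) (hcomm S hS (lp.single 2 j a))
    rw [amplify_single] at this
    exact this.symm
  have hTP : (V.starProjection).comp (amplify T) = (amplify T).comp V.starProjection := by
    refine lp.ext_continuousLinearMap (by simp) fun j => ?_
    ext a i
    change V.starProjection (amplify T (lp.single 2 j a)) i =
      T (V.starProjection (lp.single 2 j a) i)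
    rw [amplify_single]
    exact (congrArg (fun S => S a) (hPij i j)).symm
  have hTy : amplify T y ∈ V := by
    have := congrArg (fun S => S y) hTP
    change V.starProjection (amplify T y) = amplify T (V.starProjection y) at this
    rw [Submodule.starProjection_eq_self_iff.2 hyV] at this
    rw [← this]
    exact Submodule.starProjection_apply_mem _ _
  rw [hxy]
  have hcl : IsClosed {v : lp (fun _ : ℕ => L) 2 | ⟪x, v⟫_ℂ = 0} :=
    isClosed_eq (by fun_prop) continuous_const
  refine closure_minimal ?_ hcl hTy
  rintro _ ⟨S, hS, rfl⟩
  exact (hxy S).symm.trans (hp S hS)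

end Bicommutant

/-! ### Elementary tensors and polarization. -/

section PureTensor

variable {H K : Type*} [NormedAddCommGroup H] [InnerProductSpace ℂ H]
  [NormedAddCommGroup K] [InnerProductSpace ℂ K]

theorem inner_pureTensor (ξ ξ' : H) (η η' : K) :
    ⟪pureTensor ξ η, pureTensor ξ' η'⟫_ℂ = ⟪ξ, ξ'⟫_ℂ * ⟪η, η'⟫_ℂ := by
  rw [pureTensor, pureTensor, HilbertTensor.inner_incl, TensorProduct.inner_tmul]

theorem HilbertTensor.norm_incl (t : H ⊗[ℂ] K) : ‖HilbertTensor.incl t‖ = ‖t‖ :=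
  UniformSpace.Completion.norm_coe t

theorem HilbertTensor.incl_add (s t : H ⊗[ℂ] K) :
    HilbertTensor.incl (s + t) = HilbertTensor.incl s + HilbertTensor.incl t :=
  UniformSpace.Completion.coe_add s t

theorem HilbertTensor.incl_smul (c : ℂ) (t : H ⊗[ℂ] K) :
    HilbertTensor.incl (c • t) = c • HilbertTensor.incl t :=
  UniformSpace.Completion.coe_smul c t

theorem norm_pureTensor (ξ : H) (η : K) : ‖pureTensor ξ η‖ = ‖ξ‖ * ‖η‖ := by
  rw [pureTensor, HilbertTensor.norm_incl, TensorProduct.norm_tmul]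

theorem pureTensor_add_left (ξ ξ' : H) (η : K) :
    pureTensor (ξ + ξ') η = pureTensor ξ η + pureTensor ξ' η := by
  rw [pureTensor, TensorProduct.add_tmul, HilbertTensor.incl_add]; rfl

theorem pureTensor_smul_left (c : ℂ) (ξ : H) (η : K) :
    pureTensor (c • ξ) η = c • pureTensor ξ η := by
  rw [pureTensor, ← TensorProduct.smul_tmul', HilbertTensor.incl_smul]; rfl

theorem tensorOp_pureTensor (A : H →L[ℂ] H) (B : K →L[ℂ] K) (ξ : H) (η : K) :
    tensorOp A B (pureTensor ξ η) = pureTensor (A ξ) (B η) := by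
  rw [pureTensor, tensorOp_incl, TensorProduct.mapL_tmul]; rfl

/-- The elementary tensors are total. -/
theorem HilbertTensor.induction {P : HilbertTensor H K → Prop}
    (hp : ∀ ξ η, P (pureTensor ξ η)) (hadd : ∀ v w, P v → P w → P (v + w))
    (hcl : IsClosed {v | P v}) (v : HilbertTensor H K) : P v := by
  induction v using HilbertTensor.denseRange_incl.induction_on with
  | hp => exact hcl
  | ih t =>
    induction t using TensorProduct.induction_on with
    | zero => rw [← TensorProduct.zero_tmul H (0 : K)]; exact hp _ _
    | tmul ξ η => exact hp ξ η
    | add s t hs ht => rw [HilbertTensor.incl_add]; exact hadd _ _ hs ht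

theorem HilbertTensor.ext_pureTensor {S T : HilbertTensor H K →L[ℂ] HilbertTensor H K}
    (h : ∀ ξ ξ' η η', ⟪pureTensor ξ η, S (pureTensor ξ' η')⟫_ℂ =
      ⟪pureTensor ξ η, T (pureTensor ξ' η')⟫_ℂ) : S = T := by
  refine ContinuousLinearMap.ext fun w => ext_inner_left ℂ fun v => ?_
  induction w using HilbertTensor.induction with
  | hp ξ' η' =>
    induction v using HilbertTensor.induction with
    | hp ξ η => exact h ξ ξ' η η'
    | hadd v w hv hw => rw [inner_add_left, inner_add_left, hv, hw]
    | hcl => exact isClosed_eq (by fun_prop) (by fun_prop)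
  | hadd v w hv hw => rw [map_add, map_add, inner_add_right, inner_add_right, hv, hw]
  | hcl => exact isClosed_eq (by fun_prop) (by fun_prop)

/-- By polarization, an operator is determined by its matrix elements between elementary tensors
with the same first factor. -/
theorem HilbertTensor.ext_diagonal {S T : HilbertTensor H K →L[ℂ] HilbertTensor H K}
    (h : ∀ ξ η η', ⟪pureTensor ξ η, S (pureTensor ξ η')⟫_ℂ =
      ⟪pureTensor ξ η, T (pureTensor ξ η')⟫_ℂ) : S = T := by
  have h0 : ∀ ξ η η', ⟪pureTensor ξ η, (S - T) (pureTensor ξ η')⟫_ℂ = 0 := fun ξ η η' => by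
    rw [sub_apply, inner_sub_right, h, sub_self]
  refine sub_eq_zero.1 (HilbertTensor.ext_pureTensor fun ξ ξ' η η' => ?_)
  have h1 := h0 (ξ + ξ') η η'
  have h2 := h0 (ξ + Complex.I • ξ') η η'
  simp only [pureTensor_add_left, pureTensor_smul_left, map_add, map_smul, inner_add_left,
    inner_add_right, inner_smul_left, inner_smul_right, h0, Complex.conj_I, mul_zero, zero_add,
    add_zero] at h1 h2
  rw [zero_apply, inner_zero_right]
  -- With cross terms `a` and `b`, the two instances say `a + b = 0` and `i a - i b = 0`; this
  -- combination eliminates `b`.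
  have h3 : 2 * Complex.I * ⟪pureTensor ξ η, (S - T) (pureTensor ξ' η')⟫_ℂ = 0 := by
    linear_combination Complex.I * h1 + h2
  exact (mul_eq_zero.1 h3).resolve_left (by simp)

theorem tensorOp_add_left (A A' : H →L[ℂ] H) (B : K →L[ℂ] K) :
    tensorOp (A + A') B = tensorOp A B + tensorOp A' B :=
  HilbertTensor.ext_op fun t => by
    rw [add_apply, tensorOp_incl, tensorOp_incl, tensorOp_incl, ← HilbertTensor.incl_add,
      TensorProduct.mapL_add_left]
    rfl

theorem tensorOp_zero_left (B : K →L[ℂ] K) : tensorOp (0 : H →L[ℂ] H) B = 0 := by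
  simpa using tensorOp_add_left (0 : H →L[ℂ] H) 0 B

theorem tensorOp_sum_left {ι : Type*} (s : Finset ι) (A : ι → H →L[ℂ] H) (B : K →L[ℂ] K) :
    tensorOp (∑ i ∈ s, A i) B = ∑ i ∈ s, tensorOp (A i) B := by
  classical
  induction s using Finset.induction_on with
  | empty => simp [tensorOp_zero_left]
  | insert i s hi ih => rw [Finset.sum_insert hi, Finset.sum_insert hi, tensorOp_add_left, ih]

theorem norm_tensorOp_one_apply_le (B : K →L[ℂ] K) (v : HilbertTensor H K) :
    ‖tensorOp (1 : H →L[ℂ] H) B v‖ ≤ ‖B‖ * ‖v‖ := by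
  induction v using HilbertTensor.denseRange_incl.induction_on with
  | hp => exact isClosed_le (by fun_prop) (by fun_prop)
  | ih t =>
    rw [tensorOp_incl, HilbertTensor.norm_incl, HilbertTensor.norm_incl]
    refine ((TensorProduct.mapL (1 : H →L[ℂ] H) B).le_opNorm t).trans ?_
    gcongr
    refine (TensorProduct.norm_mapL_le _ _).trans ?_
    exact mul_le_of_le_one_left (norm_nonneg _) ContinuousLinearMap.norm_id_le

end PureTensor

/-! ### Weak compactness along ultrafilters. -/

section WeakLimit

/-- A bounded sequence of operators converges weakly along every ultrafilter. -/
theorem exists_weak_limit {L : Type*} [NormedAddCommGroup L] [InnerProductSpace ℂ L]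
    [CompleteSpace L] (T : ℕ → L →L[ℂ] L) {C : ℝ} (hC : 0 ≤ C)
    (hT : ∀ n v w, ‖⟪v, T n w⟫_ℂ‖ ≤ C * ‖v‖ * ‖w‖) (l : Ultrafilter ℕ) :
    ∃ S : L →L[ℂ] L, ‖S‖ ≤ C ∧ ∀ v w, Tendsto (fun n => ⟪v, T n w⟫_ℂ) l (𝓝 ⟪v, S w⟫_ℂ) := by
  -- The ultrafilter makes all matrix elements converge at once, with no diagonal choice of
  -- subsequence.
  have hex : ∀ v w, ∃ z : ℂ, Tendsto (fun n => ⟪v, T n w⟫_ℂ) l (𝓝 z) := by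
    intro v w
    obtain ⟨z, -, hz⟩ := (isCompact_closedBall (0 : ℂ) (C * ‖v‖ * ‖w‖)).ultrafilter_le_nhds
      (l.map fun n => ⟪v, T n w⟫_ℂ)
      (le_principal_iff.2 (Filter.mem_map.2 (univ_mem' fun n => by simpa using hT n v w)))
    exact ⟨z, hz⟩
  choose Z hZ using hex
  obtain ⟨S, hS, hSZ⟩ := exists_operator_of_form Z
    (fun x x' y => tendsto_nhds_unique (hZ _ _)
      (((hZ x y).add (hZ x' y)).congr fun n => (inner_add_left _ _ _).symm))
    (fun c x y => tendsto_nhds_unique (hZ _ _)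
      (((hZ x y).const_mul _).congr fun n => (inner_smul_left _ _ _).symm))
    (fun x y y' => tendsto_nhds_unique (hZ _ _)
      (((hZ x y).add (hZ x y')).congr fun n => by rw [map_add, inner_add_right]))
    (fun c x y => tendsto_nhds_unique (hZ _ _)
      (((hZ x y).const_mul _).congr fun n => by rw [map_smul, inner_smul_right]))
    C hC (fun x y => le_of_tendsto (hZ x y).norm (Eventually.of_forall fun n => hT n x y))
  exact ⟨S, hS, fun v w => by rw [hSZ]; exact hZ v w⟩

end WeakLimit

/-- A bounded operator is determined by its quadratic form. -/
theorem ContinuousLinearMap.ext_of_inner_self {H : Type*} [NormedAddCommGroup H]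
    [InnerProductSpace ℂ H] {E E' : H →L[ℂ] H}
    (h : ∀ ξ, ⟪ξ, E ξ⟫_ℂ = ⟪ξ, E' ξ⟫_ℂ) : E = E' := by
  apply ContinuousLinearMap.coe_injective
  refine (ext_inner_map (E : H →ₗ[ℂ] H) (E' : H →ₗ[ℂ] H)).1 fun x => ?_
  rw [← inner_conj_symm, ← inner_conj_symm ((E' : H →ₗ[ℂ] H) x)]
  exact congrArg _ (h x)

/-! ### Operator integrals against an observable. -/

namespace POVM

variable {S : Type*} [MeasurableSpace S] {H K : Type*} [NormedAddCommGroup H]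
  [InnerProductSpace ℂ H] [CompleteSpace H] [NormedAddCommGroup K] [InnerProductSpace ℂ K]

theorem inner_effect_eq_re (E : POVM S H) (ξ : H) {X : Set S} (hX : MeasurableSet X) :
    ⟪ξ, E.effect X ξ⟫_ℂ = ((⟪ξ, E.effect X ξ⟫_ℂ).re : ℂ) := by
  have h := (E.isPositive X hX).inner_nonneg_right ξ
  exact Complex.ext rfl (by simpa using (Complex.nonneg_iff.1 h).2.symm)

theorem bornMeasure_univ (E : POVM S H) (ξ : H) :
    E.bornMeasure ξ Set.univ = ENNReal.ofReal (‖ξ‖ ^ 2) := by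
  rw [bornMeasure_apply E ξ MeasurableSet.univ, effect_univ, one_apply_eq_self,
    inner_self_eq_norm_sq_to_K]
  norm_cast

instance isFiniteMeasure_bornMeasure (E : POVM S H) (ξ : H) :
    IsFiniteMeasure (E.bornMeasure ξ) :=
  ⟨by rw [bornMeasure_univ]; exact ENNReal.ofReal_lt_top⟩

theorem bornMeasure_real (E : POVM S H) (ξ : H) {X : Set S} (hX : MeasurableSet X) :
    ((E.bornMeasure ξ).real X : ℂ) = ⟪ξ, E.effect X ξ⟫_ℂ := by
  rw [measureReal_def, bornMeasure_apply E ξ hX, ENNReal.toReal_ofReal (E.re_nonneg ξ hX),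
    ← inner_effect_eq_re E ξ hX]

theorem bornMeasure_real_univ (E : POVM S H) (ξ : H) :
    (E.bornMeasure ξ).real Set.univ = ‖ξ‖ ^ 2 := by
  rw [measureReal_def, bornMeasure_univ, ENNReal.toReal_ofReal (by positivity)]

theorem sum_effect_preimage (E : POVM S H) {β : Type*} (s : SimpleFunc S β) :
    ∑ b ∈ s.range, E.effect (s ⁻¹' {b}) = 1 := by
  refine ContinuousLinearMap.ext_of_inner_self fun ξ => ?_
  rw [sum_apply, inner_sum]
  have h1 : ∀ b, ⟪ξ, E.effect (s ⁻¹' {b}) ξ⟫_ℂ = ((E.bornMeasure ξ).real (s ⁻¹' {b}) : ℂ) :=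
    fun b => (bornMeasure_real E ξ (s.measurableSet_preimage _)).symm
  simp only [h1]
  rw [← E.effect_univ, ← bornMeasure_real E ξ MeasurableSet.univ, ← Complex.ofReal_sum]
  congr 1
  simp only [measureReal_def]
  rw [← ENNReal.toReal_sum fun b _ => measure_ne_top _ _,
    SimpleFunc.sum_range_measure_preimage_singleton]

/-- The operator integral `∫ dE ⊗ s` of an operator-valued simple function. -/
noncomputable def simpleIntegral (E : POVM S H) (s : SimpleFunc S (K →L[ℂ] K)) :
    HilbertTensor H K →L[ℂ] HilbertTensor H K :=
  ∑ b ∈ s.range, tensorOp (E.effect (s ⁻¹' {b})) b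

theorem inner_simpleIntegral (E : POVM S H) (s : SimpleFunc S (K →L[ℂ] K)) (ξ : H) (η η' : K) :
    ⟪pureTensor ξ η, E.simpleIntegral s (pureTensor ξ η')⟫_ℂ =
      ∫ g, ⟪η, s g η'⟫_ℂ ∂(E.bornMeasure ξ) := by
  have h1 : ∫ g, ⟪η, s g η'⟫_ℂ ∂(E.bornMeasure ξ) =
      ∑ b ∈ s.range, (E.bornMeasure ξ).real (s ⁻¹' {b}) • ⟪η, b η'⟫_ℂ := by
    rw [← SimpleFunc.map_integral s (fun b : K →L[ℂ] K => ⟪η, b η'⟫_ℂ)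
      (SimpleFunc.integrable_of_isFiniteMeasure s) (by simp),
      SimpleFunc.integral_eq_integral _ (SimpleFunc.integrable_of_isFiniteMeasure _)]
    rfl
  rw [h1, simpleIntegral, sum_apply, inner_sum]
  refine Finset.sum_congr rfl fun b _ => ?_
  rw [tensorOp_pureTensor, inner_pureTensor, ← bornMeasure_real E ξ (s.measurableSet_preimage _),
    Complex.real_smul]

variable [CompleteSpace K]

/-- Factoring each effect as `R*R` and putting `P b = R b ⊗ 1`, each term becomes `⟪P b v, (1 ⊗ b) P
b w⟫`. The level sets partition `S`, so the `‖P b u‖²` add up to `‖u‖²`, and Cauchy-Schwarz bounds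
the sum without any dependence on the number of values. -/
theorem norm_inner_simpleIntegral_le (E : POVM S H) (s : SimpleFunc S (K →L[ℂ] K)) {C : ℝ}
    (hC : 0 ≤ C) (hs : ∀ g, ‖s g‖ ≤ C) (v w : HilbertTensor H K) :
    ‖⟪v, E.simpleIntegral s w⟫_ℂ‖ ≤ C * ‖v‖ * ‖w‖ := by
  have hroot : ∀ b, ∃ R : H →L[ℂ] H, star R * R = E.effect (s ⁻¹' {b}) := fun b => by
    obtain ⟨R, hR⟩ := CStarAlgebra.nonneg_iff_eq_star_mul_self.1
      ((ContinuousLinearMap.nonneg_iff_isPositive _).2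
        (E.isPositive (s ⁻¹' {b}) (s.measurableSet_preimage _)))
    exact ⟨R, hR.symm⟩
  choose R hR using hroot
  let P : (K →L[ℂ] K) → HilbertTensor H K →L[ℂ] HilbertTensor H K := fun b => tensorOp (R b) 1
  have hsq : ∀ u : HilbertTensor H K, ∑ b ∈ s.range, ‖P b u‖ ^ 2 = ‖u‖ ^ 2 := by
    intro u
    have h1 : ∀ b, ((‖P b u‖ ^ 2 : ℝ) : ℂ) = ⟪u, tensorOp (E.effect (s ⁻¹' {b})) 1 u⟫_ℂ := by
      intro b
      rw [← hR, ← one_mul (1 : K →L[ℂ] K), tensorOp_mul, mul_apply_eq_comp,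
        show tensorOp (star (R b)) (1 : K →L[ℂ] K) = star (P b) by
          rw [← tensorOp_star, star_one], ContinuousLinearMap.star_eq_adjoint,
        ContinuousLinearMap.adjoint_inner_right, inner_self_eq_norm_sq_to_K]
      norm_cast
    have h2 : ((∑ b ∈ s.range, ‖P b u‖ ^ 2 : ℝ) : ℂ) = ((‖u‖ ^ 2 : ℝ) : ℂ) := by
      rw [Complex.ofReal_sum]
      simp only [h1]
      rw [← inner_sum, ← sum_apply, ← tensorOp_sum_left, sum_effect_preimage, tensorOp_one,
        one_apply_eq_self, inner_self_eq_norm_sq_to_K]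
      norm_cast
    exact_mod_cast h2
  have hterm : ∀ b ∈ s.range, ‖⟪v, tensorOp (E.effect (s ⁻¹' {b})) b w⟫_ℂ‖ ≤
      C * (‖P b v‖ * ‖P b w‖) := by
    intro b hb
    obtain ⟨g, rfl⟩ := SimpleFunc.mem_range.1 hb
    set b := s g
    have h1 : tensorOp (E.effect (s ⁻¹' {b})) b = star (P b) * (tensorOp 1 b * P b) := by
      rw [← tensorOp_star, ← tensorOp_mul, ← tensorOp_mul, star_one, one_mul, one_mul, mul_one, hR]
    rw [h1, mul_apply_eq_comp, ContinuousLinearMap.star_eq_adjoint,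
      ContinuousLinearMap.adjoint_inner_right, mul_apply_eq_comp]
    calc _ ≤ ‖P b v‖ * ‖tensorOp 1 b (P b w)‖ := norm_inner_le_norm _ _
      _ ≤ ‖P b v‖ * (C * ‖P b w‖) := by
        gcongr
        exact (norm_tensorOp_one_apply_le _ _).trans (by gcongr; exact hs g)
      _ = _ := by ring
  have hcs : ∑ b ∈ s.range, ‖P b v‖ * ‖P b w‖ ≤ ‖v‖ * ‖w‖ := by
    refine (Real.sum_mul_le_sqrt_mul_sqrt _ _ _).trans ?_
    rw [hsq, hsq, Real.sqrt_sq (norm_nonneg _), Real.sqrt_sq (norm_nonneg _)]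
  rw [simpleIntegral, sum_apply, inner_sum]
  calc _ ≤ ∑ b ∈ s.range, ‖⟪v, tensorOp (E.effect (s ⁻¹' {b})) b w⟫_ℂ‖ := norm_sum_le _ _
    _ ≤ ∑ b ∈ s.range, C * (‖P b v‖ * ‖P b w‖) := Finset.sum_le_sum hterm
    _ ≤ C * (‖v‖ * ‖w‖) := by rw [← Finset.mul_sum]; gcongr
    _ = C * ‖v‖ * ‖w‖ := by ring

/-- Operator integrals of pointwise weak limits of uniformly bounded simple functions exist, and
are weak limits of the operator integrals of the simple functions. -/
theorem exists_weakIntegral (E : POVM S H) (f : S → K →L[ℂ] K)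
    (s : ℕ → SimpleFunc S (K →L[ℂ] K)) {C : ℝ} (hC : 0 ≤ C) (hs : ∀ n g, ‖s n g‖ ≤ C)
    (hlim : ∀ g η η', Tendsto (fun n => ⟪η, s n g η'⟫_ℂ) atTop (𝓝 ⟪η, f g η'⟫_ℂ))
    (l : Ultrafilter ℕ) (hl : (l : Filter ℕ) ≤ atTop) :
    ∃ T : HilbertTensor H K →L[ℂ] HilbertTensor H K, ‖T‖ ≤ C ∧
      (∀ ξ η η', ⟪pureTensor ξ η, T (pureTensor ξ η')⟫_ℂ =
        ∫ g, ⟪η, f g η'⟫_ℂ ∂(E.bornMeasure ξ)) ∧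
      ∀ v w, Tendsto (fun n => ⟪v, E.simpleIntegral (s n) w⟫_ℂ) l (𝓝 ⟪v, T w⟫_ℂ) := by
  obtain ⟨T, hT, hTl⟩ := exists_weak_limit (fun n => E.simpleIntegral (s n)) hC
    (fun n v w => norm_inner_simpleIntegral_le E (s n) hC (hs n) v w) l
  refine ⟨T, hT, fun ξ η η' => ?_, hTl⟩
  refine tendsto_nhds_unique (hTl _ _) (Tendsto.mono_left ?_ hl)
  simp only [inner_simpleIntegral]
  refine tendsto_integral_of_dominated_convergence (fun _ => ‖η‖ * (C * ‖η'‖)) (fun n => ?_)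
    (integrable_const _) (fun n => Eventually.of_forall fun g => ?_)
    (Eventually.of_forall fun g => hlim g η η')
  · exact ((s n).map fun b : K →L[ℂ] K => ⟪η, b η'⟫_ℂ).measurable.aestronglyMeasurable
  · refine (norm_inner_le_norm _ _).trans ?_
    gcongr
    exact ((s n g).le_opNorm _).trans (by gcongr; exact hs n g)

end POVM

/-! ### Conjugation by a projective representation. -/

namespace ProjUnitaryRep

variable {G : Type*} [Group G] [TopologicalSpace G] {K : Type*} [NormedAddCommGroup K]
  [InnerProductSpace ℂ K] [CompleteSpace K] (U : ProjUnitaryRep G K)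

/-- The action of a group element on an observable. -/
noncomputable def conjOp (A : K →L[ℂ] K) (g : G) : K →L[ℂ] K := U.op g * A * star (U.op g)

theorem star_mul_op (g : G) : star (U.op g) * U.op g = 1 := (Unitary.mem_iff.1 (U.mem_unitary g)).1

theorem op_mul_star (g : G) : U.op g * star (U.op g) = 1 := (Unitary.mem_iff.1 (U.mem_unitary g)).2

theorem norm_conjOp (A : K →L[ℂ] K) (g : G) : ‖U.conjOp A g‖ = ‖A‖ := by
  rw [conjOp, CStarRing.norm_mul_mem_unitary _ (Unitary.star_mem (U.mem_unitary g)),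
    CStarRing.norm_mem_unitary_mul _ (U.mem_unitary g)]

theorem conjOp_one_left (g : G) : U.conjOp 1 g = 1 := by
  rw [conjOp, mul_one, op_mul_star]

theorem conjOp_add (A B : K →L[ℂ] K) (g : G) :
    U.conjOp (A + B) g = U.conjOp A g + U.conjOp B g := by
  simp only [conjOp, mul_add, add_mul]

theorem conjOp_smul (c : ℂ) (A : K →L[ℂ] K) (g : G) :
    U.conjOp (c • A) g = c • U.conjOp A g := by
  simp only [conjOp, mul_smul_comm, smul_mul_assoc]

theorem conjOp_star (A : K →L[ℂ] K) (g : G) : U.conjOp (star A) g = star (U.conjOp A g) := by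
  simp only [conjOp, star_mul, star_star, mul_assoc]

theorem conjOp_mul (A B : K →L[ℂ] K) (g : G) :
    U.conjOp (A * B) g = U.conjOp A g * U.conjOp B g := by
  simp only [conjOp]
  calc U.op g * (A * B) * star (U.op g)
      = U.op g * A * 1 * B * star (U.op g) := by simp only [mul_assoc, one_mul]
    _ = _ := by rw [← star_mul_op U g]; simp only [mul_assoc]

/-- The phase of the multiplier cancels against its conjugate, so conjugation is a genuine action
even for a projective representation. -/
theorem conjOp_mul_right (A : K →L[ℂ] K) (g h : G) :
    U.conjOp A (g * h) = U.op g * U.conjOp A h * star (U.op g) := by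
  obtain ⟨c, hc, hcU⟩ := U.op_mul g h
  have hcc : c * star c = 1 := by
    rw [Complex.star_def, Complex.mul_conj, Complex.normSq_eq_norm_sq, hc]; simp
  simp only [conjOp, hcU, star_smul, star_mul, smul_mul_assoc, mul_smul_comm, smul_smul]
  rw [mul_comm, hcc, one_smul]
  simp only [mul_assoc]

/-- `U(1)` need not be the identity, but multiplicativity up to phase at `1 * 1` forces it to be a
scalar of modulus one. -/
theorem conjOp_one_right (A : K →L[ℂ] K) : U.conjOp A 1 = A := by
  obtain ⟨c, hc, hcU⟩ := U.op_mul 1 1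
  rw [mul_one] at hcU
  have h1 : c • U.op 1 = 1 := by
    have := congrArg (fun V => star (U.op 1) * V) hcU
    simp only [mul_smul_comm, ← mul_assoc, star_mul_op, one_mul] at this
    exact this.symm
  have hcc : c * star c = 1 := by
    rw [Complex.star_def, Complex.mul_conj, Complex.normSq_eq_norm_sq, hc]; simp
  calc U.conjOp A 1 = (c * star c) • U.conjOp A 1 := by rw [hcc, one_smul]
    _ = (c • U.op 1) * A * star (c • U.op 1) := by
      simp only [conjOp, star_smul, smul_mul_assoc, mul_smul_comm, smul_smul]
      rw [mul_comm]
    _ = A := by rw [h1, star_one, one_mul, mul_one]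

theorem norm_star_op_apply (g : G) (η : K) : ‖star (U.op g) η‖ = ‖η‖ := by
  have h : ⟪star (U.op g) η, star (U.op g) η⟫_ℂ = ⟪η, η⟫_ℂ := by
    rw [ContinuousLinearMap.star_eq_adjoint, ContinuousLinearMap.adjoint_inner_left,
      ← ContinuousLinearMap.star_eq_adjoint, ← mul_apply_eq_comp, op_mul_star, one_apply_eq_self]
  rw [inner_self_eq_norm_sq_to_K, inner_self_eq_norm_sq_to_K] at h
  have h' : ‖star (U.op g) η‖ ^ 2 = ‖η‖ ^ 2 := by exact_mod_cast h
  exact (sq_eq_sq₀ (norm_nonneg _) (norm_nonneg _)).1 h'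

theorem inner_conjOp (A : K →L[ℂ] K) (g : G) (η η' : K) :
    ⟪η, U.conjOp A g η'⟫_ℂ = vectorFunctional (star (U.op g) η) (star (U.op g) η') A := by
  rw [vectorFunctional_apply, conjOp, mul_assoc, mul_apply_eq_comp, mul_apply_eq_comp,
    ContinuousLinearMap.star_eq_adjoint, ContinuousLinearMap.adjoint_inner_left]

section Continuity

set_option maxSynthPendingDepth 3

/-- The states `U(g)* |η'⟩⟨η| U(g)` depend norm continuously on `g`. -/
theorem continuous_vectorFunctional_star (η η' : K) :
    Continuous fun g => vectorFunctional (star (U.op g) η) (star (U.op g) η') := by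
  refine continuous_iff_continuousAt.2 fun g₀ => ?_
  obtain ⟨c, hc, hcU⟩ := U.continuous_mod_phase g₀
  have hcc : ∀ g, starRingEnd ℂ (c g) * c g = 1 := fun g => by
    rw [mul_comm, Complex.mul_conj, Complex.normSq_eq_norm_sq, hc]; simp
  have hphase : ∀ g, vectorFunctional (star (c g) • star (U.op g) η) (star (c g) • star (U.op g) η')
      = vectorFunctional (star (U.op g) η) (star (U.op g) η') := fun g => by
    ext A
    rw [vectorFunctional_apply, vectorFunctional_apply, map_smul, inner_smul_left,
      inner_smul_right, ← mul_assoc, Complex.star_def, Complex.conj_conj, mul_comm (c g), hcc,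
      one_mul]
  have hlim : ∀ ζ, Tendsto (fun g => star (c g) • star (U.op g) ζ) (𝓝 g₀)
      (𝓝 (star (U.op g₀) ζ)) := fun ζ => by
    rw [tendsto_iff_norm_sub_tendsto_zero]
    -- Strong convergence is assumed for `U`, not for its adjoints. Unitarity reduces the squared
    -- distance between the adjoints to one matrix element of `U`, which converges.
    have hsq : ∀ g, ‖star (c g) • star (U.op g) ζ - star (U.op g₀) ζ‖ ^ 2 =
        2 * ‖ζ‖ ^ 2 - 2 * (⟪ζ, c g • U.op g (star (U.op g₀) ζ)⟫_ℂ).re := fun g => by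
      rw [@norm_sub_sq ℂ, norm_smul, norm_star, hc, one_mul, norm_star_op_apply,
        norm_star_op_apply, inner_smul_left, inner_smul_right, Complex.star_def, Complex.conj_conj,
        ContinuousLinearMap.star_eq_adjoint, ContinuousLinearMap.adjoint_inner_left]
      simp only [RCLike.re_to_complex]
      ring
    have h1 : Tendsto (fun g => 2 * ‖ζ‖ ^ 2 -
        2 * (⟪ζ, c g • U.op g (star (U.op g₀) ζ)⟫_ℂ).re) (𝓝 g₀) (𝓝 0) := by
      have h2 := (Complex.continuous_re.tendsto _).comp
        ((tendsto_const_nhds (x := ζ)).inner (𝕜 := ℂ) (hcU (star (U.op g₀) ζ)))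
      have h3 := (h2.const_mul 2).const_sub (2 * ‖ζ‖ ^ 2)
      have e : 2 * ‖ζ‖ ^ 2 - 2 * (⟪ζ, U.op g₀ (star (U.op g₀) ζ)⟫_ℂ).re = 0 := by
        rw [← mul_apply_eq_comp, op_mul_star, one_apply_eq_self]
        have := inner_self_eq_norm_sq (𝕜 := ℂ) ζ
        simp only [RCLike.re_to_complex] at this
        linarith
      rw [e] at h3
      exact h3
    have h4 := (Real.continuous_sqrt.tendsto 0).comp
      (h1.congr fun g => (hsq g).symm)
    rw [Real.sqrt_zero] at h4
    exact h4.congr fun g => Real.sqrt_sq (norm_nonneg _)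
  have h5 := (continuous_vectorFunctional (H := K)).tendsto (star (U.op g₀) η, star (U.op g₀) η')
  exact (h5.comp ((hlim η).prodMk_nhds (hlim η'))).congr hphase

theorem continuous_inner_conjOp (A : K →L[ℂ] K) (η η' : K) :
    Continuous fun g => ⟪η, U.conjOp A g η'⟫_ℂ := by
  simp only [inner_conjOp]
  exact (ContinuousLinearMap.apply ℂ ℂ A).continuous.comp (U.continuous_vectorFunctional_star η η')

end Continuity

theorem norm_inner_conjOp_le (A : K →L[ℂ] K) (g : G) (η η' : K) :
    ‖⟪η, U.conjOp A g η'⟫_ℂ‖ ≤ ‖A‖ * ‖η‖ * ‖η'‖ := by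
  calc _ ≤ ‖η‖ * ‖U.conjOp A g η'‖ := norm_inner_le_norm _ _
    _ ≤ ‖η‖ * (‖A‖ * ‖η'‖) := by
      gcongr
      rw [← U.norm_conjOp A g]
      exact ContinuousLinearMap.le_opNorm _ _
    _ = _ := by ring

end ProjUnitaryRep

/-- On a second countable Hausdorff group, the identity is a pointwise limit of simple functions. -/
theorem exists_simpleFunc_tendsto_id (G : Type*) [Group G] [TopologicalSpace G]
    [IsTopologicalGroup G] [SecondCountableTopology G] [T2Space G] [MeasurableSpace G]
    [BorelSpace G] : ∃ γ : ℕ → SimpleFunc G G, ∀ g, Tendsto (fun n => γ n g) atTop (𝓝 g) := by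
  let := TopologicalSpace.metrizableSpaceMetric G
  exact ⟨SimpleFunc.approxOn id measurable_id Set.univ 1 (Set.mem_univ _), fun g =>
    SimpleFunc.tendsto_approxOn measurable_id _ (by simp)⟩

/-! ### Relativization: existence, isometry, normality. -/

namespace PrincipalFrame

set_option linter.unusedSectionVars false

variable {G : Type*} [Group G] [TopologicalSpace G] [IsTopologicalGroup G]
  [SecondCountableTopology G] [T2Space G] [MeasurableSpace G] [BorelSpace G]
  {HR HS : Type*} [NormedAddCommGroup HR] [InnerProductSpace ℂ HR] [CompleteSpace HR]
  [NormedAddCommGroup HS] [InnerProductSpace ℂ HS] [CompleteSpace HS]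
  (R : PrincipalFrame G HR) (U : ProjUnitaryRep G HS)

theorem integrable_inner_conjOp (A : HS →L[ℂ] HS) (ξ : HR) (η η' : HS) :
    Integrable (fun g => ⟪η, U.conjOp A g η'⟫_ℂ) (R.obs.bornMeasure ξ) :=
  Integrable.of_bound (U.continuous_inner_conjOp A η η').aestronglyMeasurable _
    (Eventually.of_forall fun g => U.norm_inner_conjOp_le A g η η')

/-- The approximation `γ` and the ultrafilter do not depend on `A`, so two operators can be
approximated simultaneously; multiplicativity relies on this. -/
theorem exists_isWeakIntegral_approx (γ : ℕ → SimpleFunc G G)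
    (hγ : ∀ g, Tendsto (fun n => γ n g) atTop (𝓝 g)) (A : HS →L[ℂ] HS) (l : Ultrafilter ℕ)
    (hl : (l : Filter ℕ) ≤ atTop) :
    ∃ T, ‖T‖ ≤ ‖A‖ ∧ R.IsWeakIntegral U A T ∧ ∀ v w, Tendsto (fun n =>
      ⟪v, R.obs.simpleIntegral ((γ n).map (U.conjOp A)) w⟫_ℂ) l (𝓝 ⟪v, T w⟫_ℂ) :=
  R.obs.exists_weakIntegral (U.conjOp A) (fun n => (γ n).map (U.conjOp A)) (norm_nonneg A)
    (fun _ _ => (U.norm_conjOp A _).le)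
    (fun g η η' => ((U.continuous_inner_conjOp A η η').tendsto g).comp (hγ g)) l hl

theorem IsWeakIntegral.unique {R : PrincipalFrame G HR} {U : ProjUnitaryRep G HS}
    {A : HS →L[ℂ] HS} {T T' : HilbertTensor HR HS →L[ℂ] HilbertTensor HR HS}
    (h : R.IsWeakIntegral U A T) (h' : R.IsWeakIntegral U A T') : T = T' :=
  HilbertTensor.ext_diagonal fun ξ η η' => (h ξ η η').trans (h' ξ η η').symm

theorem exists_isWeakIntegral (A : HS →L[ℂ] HS) : ∃ T, ‖T‖ ≤ ‖A‖ ∧ R.IsWeakIntegral U A T := by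
  obtain ⟨γ, hγ⟩ := exists_simpleFunc_tendsto_id G
  obtain ⟨T, h1, h2, -⟩ := R.exists_isWeakIntegral_approx U γ hγ A (hyperfilter ℕ)
    (by rw [← Nat.cofinite_eq_atTop]; exact hyperfilter_le_cofinite)
  exact ⟨T, h1, h2⟩

theorem isWeakIntegral_relativize (A : HS →L[ℂ] HS) :
    R.IsWeakIntegral U A (R.relativize U A) := by
  have h : ∃ T, R.IsWeakIntegral U A T := (R.exists_isWeakIntegral U A).imp fun T h => h.2
  rw [relativize, dif_pos h]
  exact h.choose_spec

theorem isWeakIntegral_iff (A : HS →L[ℂ] HS)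
    (T : HilbertTensor HR HS →L[ℂ] HilbertTensor HR HS) :
    R.IsWeakIntegral U A T ↔ T = R.relativize U A :=
  ⟨fun h => h.unique (R.isWeakIntegral_relativize U A),
    fun h => h ▸ R.isWeakIntegral_relativize U A⟩

theorem inner_relativize (A : HS →L[ℂ] HS) (ξ : HR) (η η' : HS) :
    ⟪pureTensor ξ η, R.relativize U A (pureTensor ξ η')⟫_ℂ =
      ∫ g, ⟪η, U.conjOp A g η'⟫_ℂ ∂(R.obs.bornMeasure ξ) :=
  R.isWeakIntegral_relativize U A ξ η η'

theorem norm_relativize_le (A : HS →L[ℂ] HS) : ‖R.relativize U A‖ ≤ ‖A‖ := by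
  obtain ⟨T, h1, h2⟩ := R.exists_isWeakIntegral U A
  rwa [← (R.isWeakIntegral_iff U A T).1 h2]

theorem relativize_add (A B : HS →L[ℂ] HS) :
    R.relativize U (A + B) = R.relativize U A + R.relativize U B :=
  HilbertTensor.ext_diagonal fun ξ η η' => by
    rw [add_apply, inner_add_right, inner_relativize, inner_relativize, inner_relativize,
      ← integral_add (R.integrable_inner_conjOp U A ξ η η') (R.integrable_inner_conjOp U B ξ η η')]
    simp only [ProjUnitaryRep.conjOp_add, add_apply, inner_add_right]

theorem relativize_smul (c : ℂ) (A : HS →L[ℂ] HS) :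
    R.relativize U (c • A) = c • R.relativize U A :=
  HilbertTensor.ext_diagonal fun ξ η η' => by
    rw [smul_apply, inner_smul_right, inner_relativize, inner_relativize, ← integral_const_mul]
    simp only [ProjUnitaryRep.conjOp_smul, smul_apply, inner_smul_right]

theorem relativize_star (A : HS →L[ℂ] HS) :
    R.relativize U (star A) = star (R.relativize U A) :=
  HilbertTensor.ext_diagonal fun ξ η η' => by
    rw [ContinuousLinearMap.star_eq_adjoint (R.relativize U A),
      ContinuousLinearMap.adjoint_inner_right,
      ← inner_conj_symm (R.relativize U A (pureTensor ξ η)), inner_relativize,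
      inner_relativize, ← integral_conj]
    refine integral_congr_ae (Eventually.of_forall fun g => ?_)
    change ⟪η, U.conjOp (star A) g η'⟫_ℂ = starRingEnd ℂ _
    rw [inner_conj_symm, ProjUnitaryRep.conjOp_star, ContinuousLinearMap.star_eq_adjoint,
      ContinuousLinearMap.adjoint_inner_right]

theorem relativize_one : R.relativize U 1 = 1 :=
  HilbertTensor.ext_diagonal fun ξ η η' => by
    rw [inner_relativize]
    simp only [ProjUnitaryRep.conjOp_one_left, one_apply_eq_self]
    rw [integral_const, R.obs.bornMeasure_real_univ, inner_pureTensor, inner_self_eq_norm_sq_to_K,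
      Complex.real_smul]
    norm_cast

/-- Relativization as a linear map. -/
noncomputable def relativizeL :
    (HS →L[ℂ] HS) →ₗ[ℂ] (HilbertTensor HR HS →L[ℂ] HilbertTensor HR HS) where
  toFun := R.relativize U
  map_add' := R.relativize_add U
  map_smul' := R.relativize_smul U

/-- Otherwise covariance makes the effects of all translates of `X` vanish. Countably many
translates cover `G`, so the Born measure of a nonzero vector would be zero. -/
theorem effect_ne_zero_of_isOpen [Nontrivial HR] {X : Set G} (hX : IsOpen X) (h1 : (1 : G) ∈ X) :
    R.obs.effect X ≠ 0 := by
  intro h0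
  obtain ⟨ξ, hξ⟩ := exists_ne (0 : HR)
  have hopen : ∀ g : G, IsOpen ((fun x => g * x) '' X) := fun g => isOpenMap_mul_left g X hX
  have hzero : ∀ g : G, R.obs.bornMeasure ξ ((fun x => g * x) '' X) = 0 := fun g => by
    rw [R.obs.bornMeasure_apply ξ (hopen g).measurableSet, R.covariant g X hX.measurableSet, h0]
    simp
  obtain ⟨t, ht, hcov⟩ := TopologicalSpace.isOpen_iUnion_countable _ hopen
  have huniv : ⋃ g : G, (fun x => g * x) '' X = Set.univ :=
    Set.eq_univ_of_forall fun g => Set.mem_iUnion.2 ⟨g, 1, h1, mul_one g⟩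
  have h2 : R.obs.bornMeasure ξ Set.univ = 0 := by
    rw [← huniv, ← hcov]
    exact (measure_biUnion_null_iff ht).2 fun g _ => hzero g
  rw [R.obs.bornMeasure_univ, ENNReal.ofReal_eq_zero] at h2
  have := norm_pos_iff.2 hξ
  nlinarith

/-- The integrand `φ` is continuous with value `⟪η, A η'⟫` at `1`. A state localized where `φ` is
within `ε` of that value reproduces it up to `ε`, plus at most `ε` times the oscillation bound `2 *
M` from the complement. -/
theorem norm_inner_le_norm_relativize [Nontrivial HR] (hloc : R.obs.IsLocalizable)
    (A : HS →L[ℂ] HS) (η η' : HS) :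
    ‖⟪η, A η'⟫_ℂ‖ ≤ ‖R.relativize U A‖ * ‖η‖ * ‖η'‖ := by
  set M := ‖A‖ * ‖η‖ * ‖η'‖ with hM
  have hM0 : 0 ≤ M := by positivity
  have key : ∀ ε : ℝ, 0 < ε →
      ‖⟪η, A η'⟫_ℂ‖ ≤ ‖R.relativize U A‖ * ‖η‖ * ‖η'‖ + ε * (1 + 2 * M) := by
    intro ε hε
    let φ : G → ℂ := fun g => ⟪η, U.conjOp A g η'⟫_ℂ
    have hφ : Continuous φ := U.continuous_inner_conjOp A η η'
    have hφ1 : φ 1 = ⟪η, A η'⟫_ℂ := by simp only [φ, U.conjOp_one_right]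
    let X : Set G := {g | ‖φ g - φ 1‖ < ε}
    have hX : IsOpen X := isOpen_lt (by fun_prop) continuous_const
    obtain ⟨ξ, hξ, hξX⟩ := hloc X hX.measurableSet
      (R.effect_ne_zero_of_isOpen hX (by simpa [X] using hε)) ε hε
    set μ := R.obs.bornMeasure ξ
    have hμ1 : μ.real Set.univ = 1 := by
      rw [R.obs.bornMeasure_real_univ, hξ, one_pow]
    have hμX : 1 - ε < μ.real X := by
      rwa [measureReal_def, R.obs.bornMeasure_apply ξ hX.measurableSet,
        ENNReal.toReal_ofReal (R.obs.re_nonneg ξ hX.measurableSet)]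
    have hμXc : μ.real Xᶜ ≤ ε := by
      rw [measureReal_compl hX.measurableSet, hμ1]
      linarith
    have hbound : ∀ g, ‖φ g - φ 1‖ ≤ ε + Xᶜ.indicator (fun _ => 2 * M) g := by
      intro g
      by_cases hg : g ∈ X
      · rw [Set.indicator_of_notMem (by simpa using hg), add_zero]
        exact le_of_lt hg
      · rw [Set.indicator_of_mem (by simpa using hg)]
        have h1 := norm_sub_le (φ g) (φ 1)
        have h2 := U.norm_inner_conjOp_le A g η η'
        have h3 := U.norm_inner_conjOp_le A 1 η η'
        linarith
    have hint : ‖∫ g, (φ g - φ 1) ∂μ‖ ≤ ε * (1 + 2 * M) := by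
      calc _ ≤ ∫ g, (ε + Xᶜ.indicator (fun _ => 2 * M) g) ∂μ :=
            norm_integral_le_of_norm_le ((integrable_const _).add
              ((integrable_const _).indicator hX.measurableSet.compl))
              (Eventually.of_forall hbound)
        _ = ε + μ.real Xᶜ * (2 * M) := by
            rw [integral_add (integrable_const _)
              ((integrable_const _).indicator hX.measurableSet.compl), integral_const, hμ1,
              integral_indicator_const _ hX.measurableSet.compl, smul_eq_mul, smul_eq_mul, one_mul]
        _ ≤ ε + ε * (2 * M) := by gcongr
        _ = _ := by ring
    rw [integral_sub (R.integrable_inner_conjOp U A ξ η η') (integrable_const _), integral_const,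
      hμ1, one_smul, hφ1, ← R.inner_relativize U A ξ η η'] at hint
    have h4 : ‖⟪pureTensor ξ η, R.relativize U A (pureTensor ξ η')⟫_ℂ‖ ≤
        ‖R.relativize U A‖ * ‖η‖ * ‖η'‖ := by
      calc _ ≤ ‖pureTensor ξ η‖ * (‖R.relativize U A‖ * ‖pureTensor ξ η'‖) :=
            (norm_inner_le_norm _ _).trans (by gcongr; exact ContinuousLinearMap.le_opNorm _ _)
        _ = _ := by rw [norm_pureTensor, norm_pureTensor, hξ]; ring
    have h5 := norm_sub_norm_le ⟪η, A η'⟫_ℂ ⟪pureTensor ξ η, R.relativize U A (pureTensor ξ η')⟫_ℂ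
    rw [norm_sub_rev] at h5
    linarith
  refine le_of_forall_pos_le_add fun δ hδ => ?_
  refine (key (δ / (1 + 2 * M)) (by positivity)).trans (le_of_eq ?_)
  field_simp

theorem norm_relativize [Nontrivial HR] (hloc : R.obs.IsLocalizable) (A : HS →L[ℂ] HS) :
    ‖R.relativize U A‖ = ‖A‖ := by
  refine le_antisymm (R.norm_relativize_le U A) ?_
  refine ContinuousLinearMap.opNorm_le_bound _ (norm_nonneg _) fun y => ?_
  have h := R.norm_inner_le_norm_relativize U hloc A (A y) y
  rw [inner_self_eq_norm_sq_to_K, norm_pow, RCLike.norm_ofReal, abs_norm, sq] at h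
  rcases (norm_nonneg (A y)).eq_or_lt with h0 | h0
  · rw [← h0]; positivity
  · nlinarith

section Normality

set_option maxSynthPendingDepth 3

/-- Relativization is normal: its matrix elements are normal functionals. -/
theorem exists_normal_inner_relativize (x y : HilbertTensor HR HS) :
    ∃ φ ∈ normalFunctionals HS, ∀ A, φ A = ⟪x, R.relativize U A y⟫_ℂ := by
  let Yc : (HS →L[ℂ] HS) →L[ℂ] (HilbertTensor HR HS →L[ℂ] HilbertTensor HR HS) :=
    (R.relativizeL U).mkContinuous 1 fun A => by
      rw [one_mul]; exact R.norm_relativize_le U A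
  let Ψ : HilbertTensor HR HS → HilbertTensor HR HS → StrongDual ℂ (HS →L[ℂ] HS) :=
    fun x y => (vectorFunctional x y).comp Yc
  have hΨ : ∀ x y A, Ψ x y A = ⟪x, R.relativize U A y⟫_ℂ := fun x y A => rfl
  have hΨc : Continuous fun p : HilbertTensor HR HS × HilbertTensor HR HS => Ψ p.1 p.2 :=
    ((ContinuousLinearMap.precomp ℂ Yc).continuous).comp continuous_vectorFunctional
  have hdiag : ∀ (ξ : HR) (η η' : HS),
      Ψ (pureTensor ξ η) (pureTensor ξ η') ∈ normalFunctionals HS := by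
    intro ξ η η'
    -- The integrand is norm continuous with values in the predual, so its Bochner integral stays
    -- there; evaluation at `A` commutes with the integral.
    let D : G → normalFunctionals HS := fun g => vectorNormal (star (U.op g) η) (star (U.op g) η')
    have hDc : Continuous D := (U.continuous_vectorFunctional_star η η').subtype_mk _
    have : SecondCountableTopologyEither G (normalFunctionals HS) :=
      secondCountableTopologyEither_of_left G _
    have hDi : Integrable D (R.obs.bornMeasure ξ) :=
      Integrable.of_bound hDc.aestronglyMeasurable (‖η‖ * ‖η'‖) (Eventually.of_forall fun g => by
        refine (norm_vectorFunctional_le _ _).trans (le_of_eq ?_)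
        rw [U.norm_star_op_apply, U.norm_star_op_apply])
    have he : Ψ (pureTensor ξ η) (pureTensor ξ η') =
        ((∫ g, D g ∂(R.obs.bornMeasure ξ) : normalFunctionals HS) :
          StrongDual ℂ (HS →L[ℂ] HS)) := by
      ext A
      rw [hΨ, inner_relativize, ← predualEval_apply, ← (predualEval A).integral_comp_comm hDi]
      refine integral_congr_ae (Eventually.of_forall fun g => ?_)
      exact U.inner_conjOp A g η η'
    rw [he]
    exact Subtype.coe_prop _
  have helem : ∀ (ξ ξ' : HR) (η η' : HS),
      Ψ (pureTensor ξ η) (pureTensor ξ' η') ∈ normalFunctionals HS := by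
    intro ξ ξ' η η'
    have h1 := hdiag (ξ + ξ') η η'
    have h2 := hdiag (ξ + Complex.I • ξ') η η'
    have h3 := add_mem (hdiag ξ η η') (hdiag ξ' η η')
    -- Polarization in the first tensor factor, written as a linear combination of diagonal
    -- functionals.
    have h4 := Submodule.smul_mem _ (2 * Complex.I)⁻¹
      (add_mem (Submodule.smul_mem _ Complex.I (sub_mem h1 h3)) (sub_mem h2 h3))
    convert h4 using 1
    rw [eq_inv_smul_iff₀ (by simp)]
    ext A
    simp only [add_apply, sub_apply, smul_apply, hΨ, pureTensor_add_left, pureTensor_smul_left,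
      map_add, map_smul, inner_add_left, inner_add_right, inner_smul_left, inner_smul_right,
      Complex.conj_I, smul_eq_mul]
    linear_combination
      ⟪pureTensor ξ' η, R.relativize U A (pureTensor ξ' η')⟫_ℂ * Complex.I_sq
  refine ⟨Ψ x y, ?_, hΨ x y⟩
  induction y using HilbertTensor.induction with
  | hp ξ' η' =>
    induction x using HilbertTensor.induction with
    | hp ξ η => exact helem ξ ξ' η η'
    | hadd v w hv hw =>
      have : Ψ (v + w) (pureTensor ξ' η') = Ψ v (pureTensor ξ' η') + Ψ w (pureTensor ξ' η') := by
        ext A; simp only [add_apply, hΨ, inner_add_left]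
      rw [this]
      exact add_mem hv hw
    | hcl =>
      exact isClosed_normalFunctionals.preimage
        (hΨc.comp (continuous_id.prodMk continuous_const))
  | hadd v w hv hw =>
    have : Ψ x (v + w) = Ψ x v + Ψ x w := by
      ext A; simp only [add_apply, hΨ, map_add, inner_add_right]
    rw [this]
    exact add_mem hv hw
  | hcl =>
    exact isClosed_normalFunctionals.preimage (hΨc.comp (continuous_const.prodMk continuous_id))

end Normality

end PrincipalFrame

/-! ### Sharp observables. -/

namespace POVM

variable {S : Type*} [MeasurableSpace S] {H K : Type*} [NormedAddCommGroup H]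
  [InnerProductSpace ℂ H] [CompleteSpace H] [NormedAddCommGroup K] [InnerProductSpace ℂ K]

theorem effect_union (E : POVM S H) {X Y : Set S} (hX : MeasurableSet X) (hY : MeasurableSet Y)
    (hd : Disjoint X Y) : E.effect (X ∪ Y) = E.effect X + E.effect Y :=
  ContinuousLinearMap.ext_of_inner_self fun ξ => by
    rw [add_apply, inner_add_right, ← E.bornMeasure_real ξ (hX.union hY),
      ← E.bornMeasure_real ξ hX, ← E.bornMeasure_real ξ hY, measureReal_union hd hY]
    push_cast
    rfl

namespace IsSharp

variable {E : POVM S H} (hE : E.IsSharp)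

include hE

/-- The sum of the projections `p` and `q` is again a projection, so `pq + qp = 0`. Multiplying by
`p` on either side gives `pq = -pqp = qp`, whence `2pq = 0`. -/
theorem effect_mul_of_disjoint {X Y : Set S} (hX : MeasurableSet X) (hY : MeasurableSet Y)
    (hd : Disjoint X Y) : E.effect X * E.effect Y = 0 := by
  have hp := (hE X hX).isIdempotentElem.eq
  have hq := (hE Y hY).isIdempotentElem.eq
  have hs := (hE _ (hX.union hY)).isIdempotentElem.eq
  rw [E.effect_union hX hY hd] at hs
  generalize E.effect X = p at *
  generalize E.effect Y = q at *
  have h1 : p * q + q * p = 0 := by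
    have e : (p + q) * (p + q) = p * p + q * q + (p * q + q * p) := by noncomm_ring
    rw [e, hp, hq] at hs
    simpa using hs
  have h2 : p * q + p * q * p = 0 := by
    have := congrArg (fun t => p * t) h1
    simpa [mul_add, ← mul_assoc, hp] using this
  have h3 : p * q * p + q * p = 0 := by
    have := congrArg (fun t => t * p) h1
    simpa [add_mul, mul_assoc, hp] using this
  have h4 : p * q = q * p := by
    rw [eq_neg_of_add_eq_zero_left h2, eq_neg_of_add_eq_zero_right h3]
  rw [← h4, ← two_smul ℂ] at h1
  exact (smul_eq_zero.1 h1).resolve_left two_ne_zero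

theorem effect_mul {X Y : Set S} (hX : MeasurableSet X) (hY : MeasurableSet Y) :
    E.effect X * E.effect Y = E.effect (X ∩ Y) := by
  have h1 : E.effect X = E.effect (X ∩ Y) + E.effect (X \ Y) := by
    rw [← E.effect_union (hX.inter hY) (hX.diff hY) disjoint_inf_sdiff,
      Set.inter_union_sdiff]
  have h2 : E.effect Y = E.effect (X ∩ Y) + E.effect (Y \ X) := by
    rw [Set.inter_comm, ← E.effect_union (hY.inter hX) (hY.diff hX) disjoint_inf_sdiff,
      Set.inter_union_sdiff]
  have hd : Disjoint (X ∩ Y) (Y \ X) := Set.disjoint_left.2 fun x h h' => h'.2 h.1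
  have hd' : Disjoint (X \ Y) Y := Set.disjoint_left.2 fun x h h' => h.2 h'
  calc E.effect X * E.effect Y
      = E.effect (X ∩ Y) * E.effect Y + E.effect (X \ Y) * E.effect Y := by
        rw [← add_mul, ← h1]
    _ = E.effect (X ∩ Y) * E.effect (X ∩ Y) + E.effect (X ∩ Y) * E.effect (Y \ X) := by
        rw [hE.effect_mul_of_disjoint (hX.diff hY) hY hd', add_zero, ← mul_add, ← h2]
    _ = E.effect (X ∩ Y) := by
        rw [hE.effect_mul_of_disjoint (hX.inter hY) (hY.diff hX) hd, add_zero,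
          (hE _ (hX.inter hY)).isIdempotentElem.eq]

/-- `E(X)E(Y) = E(X ∩ Y)` turns the double sum into a sum over the joint level sets of `s` and `t`;
pairs of values not attained jointly contribute zero. -/
theorem inner_simpleIntegral_mul (s t : SimpleFunc S (K →L[ℂ] K)) (ξ : H) (η η' : K) :
    ⟪pureTensor ξ η, (E.simpleIntegral s * E.simpleIntegral t) (pureTensor ξ η')⟫_ℂ =
      ∫ g, ⟪η, (s g * t g) η'⟫_ℂ ∂(E.bornMeasure ξ) := by
  have h1 : ∫ g, ⟪η, (s g * t g) η'⟫_ℂ ∂(E.bornMeasure ξ) =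
      ∑ p ∈ (s.pair t).range, (E.bornMeasure ξ).real (s.pair t ⁻¹' {p}) •
        ⟪η, (p.1 * p.2) η'⟫_ℂ := by
    rw [← SimpleFunc.map_integral (s.pair t)
      (fun p : (K →L[ℂ] K) × (K →L[ℂ] K) => ⟪η, (p.1 * p.2) η'⟫_ℂ)
      (SimpleFunc.integrable_of_isFiniteMeasure _) (by simp),
      SimpleFunc.integral_eq_integral _ (SimpleFunc.integrable_of_isFiniteMeasure _)]
    rfl
  have h2 : (s.pair t).range ⊆ s.range ×ˢ t.range := by
    intro p hp
    obtain ⟨g, rfl⟩ := SimpleFunc.mem_range.1 hp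
    exact Finset.mem_product.2 ⟨s.mem_range_self g, t.mem_range_self g⟩
  rw [h1, Finset.sum_subset h2 (fun p _ hp => by
    rw [(SimpleFunc.preimage_eq_empty_iff _ _).2 hp, measureReal_empty, zero_smul]),
    Finset.sum_product, simpleIntegral, simpleIntegral, Finset.sum_mul_sum, sum_apply, inner_sum]
  refine Finset.sum_congr rfl fun b _ => ?_
  rw [sum_apply, inner_sum]
  refine Finset.sum_congr rfl fun c _ => ?_
  have hb := s.measurableSet_preimage {b}
  have hc := t.measurableSet_preimage {c}
  rw [← tensorOp_mul, hE.effect_mul hb hc, tensorOp_pureTensor, inner_pureTensor,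
    ← E.bornMeasure_real ξ (hb.inter hc), SimpleFunc.pair_preimage_singleton, Complex.real_smul]

end IsSharp

end POVM

/-! ### Multiplicativity, invariance and the algebra of relative operators. -/

namespace PrincipalFrame

set_option linter.unusedSectionVars false

variable {G : Type*} [Group G] [TopologicalSpace G] [IsTopologicalGroup G]
  [SecondCountableTopology G] [T2Space G] [MeasurableSpace G] [BorelSpace G]
  {HR HS : Type*} [NormedAddCommGroup HR] [InnerProductSpace ℂ HR] [CompleteSpace HR]
  [NormedAddCommGroup HS] [InnerProductSpace ℂ HS] [CompleteSpace HS]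
  (R : PrincipalFrame G HR) (U : ProjUnitaryRep G HS)

/-- For a sharp frame, relativization is multiplicative. -/
theorem relativize_mul (hE : R.obs.IsSharp) (A B : HS →L[ℂ] HS) :
    R.relativize U (A * B) = R.relativize U A * R.relativize U B := by
  obtain ⟨γ, hγ⟩ := exists_simpleFunc_tendsto_id G
  have hl : (hyperfilter ℕ : Filter ℕ) ≤ atTop := by
    rw [← Nat.cofinite_eq_atTop]; exact hyperfilter_le_cofinite
  obtain ⟨TA, -, hTA, hlimA⟩ := R.exists_isWeakIntegral_approx U γ hγ A (hyperfilter ℕ) hl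
  obtain ⟨TB, -, hTB, hlimB⟩ := R.exists_isWeakIntegral_approx U γ hγ B (hyperfilter ℕ) hl
  rw [← (R.isWeakIntegral_iff U A TA).1 hTA, ← (R.isWeakIntegral_iff U B TB).1 hTB]
  refine HilbertTensor.ext_diagonal fun ξ η η' => ?_
  set μ := R.obs.bornMeasure ξ
  let sA := fun n => (γ n).map (U.conjOp A)
  let sB := fun n => (γ n).map (U.conjOp B)
  have hsplit : ∀ (a b : HS →L[ℂ] HS), ⟪η, (a * b) η'⟫_ℂ = ⟪star a η, b η'⟫_ℂ := fun a b => by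
    rw [mul_apply_eq_comp, ContinuousLinearMap.star_eq_adjoint,
      ContinuousLinearMap.adjoint_inner_left]
  have hbound : ∀ g h, ‖⟪η, (U.conjOp A g * U.conjOp B h) η'⟫_ℂ‖ ≤ ‖η‖ * (‖A‖ * ‖B‖ * ‖η'‖) := by
    intro g h
    refine (norm_inner_le_norm _ _).trans ?_
    gcongr
    refine (ContinuousLinearMap.le_opNorm _ _).trans ?_
    gcongr
    refine (norm_mul_le _ _).trans ?_
    rw [U.norm_conjOp, U.norm_conjOp]
  have hmeas : ∀ n m, AEStronglyMeasurable (fun g => ⟪η, (sA n g * sB m g) η'⟫_ℂ) μ := fun n m =>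
    (((sA n).pair (sB m)).map fun p : (HS →L[ℂ] HS) × (HS →L[ℂ] HS) =>
      ⟪η, (p.1 * p.2) η'⟫_ℂ).measurable.aestronglyMeasurable
  have hpt1 : ∀ n g, Tendsto (fun m => ⟪η, (sA n g * sB m g) η'⟫_ℂ) atTop
      (𝓝 ⟪η, (sA n g * U.conjOp B g) η'⟫_ℂ) := fun n g => by
    simp only [hsplit]
    exact ((U.continuous_inner_conjOp B _ η').tendsto g).comp (hγ g)
  have hpt2 : ∀ g, Tendsto (fun n => ⟪η, (sA n g * U.conjOp B g) η'⟫_ℂ) atTop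
      (𝓝 ⟪η, U.conjOp (A * B) g η'⟫_ℂ) := fun g => by
    rw [ProjUnitaryRep.conjOp_mul]
    simp only [mul_apply_eq_comp]
    exact ((U.continuous_inner_conjOp A η (U.conjOp B g η')).tendsto g).comp (hγ g)
  -- Multiplication is not jointly weakly continuous, so the limits are taken one at a time: first
  -- in the approximation of `B` with `n` fixed, then in that of `A`.
  have hstep : ∀ n, ⟪pureTensor ξ η, R.obs.simpleIntegral (sA n) (TB (pureTensor ξ η'))⟫_ℂ =
      ∫ g, ⟪η, (sA n g * U.conjOp B g) η'⟫_ℂ ∂μ := fun n => by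
    have h1 := hlimB (star (R.obs.simpleIntegral (sA n)) (pureTensor ξ η)) (pureTensor ξ η')
    simp only [ContinuousLinearMap.star_eq_adjoint,
      ContinuousLinearMap.adjoint_inner_left] at h1
    have h2 : Tendsto (fun m => ∫ g, ⟪η, (sA n g * sB m g) η'⟫_ℂ ∂μ) atTop
        (𝓝 (∫ g, ⟪η, (sA n g * U.conjOp B g) η'⟫_ℂ ∂μ)) :=
      tendsto_integral_of_dominated_convergence _ (fun m => hmeas n m) (integrable_const _)
        (fun m => Eventually.of_forall fun g => hbound _ _)
        (Eventually.of_forall fun g => hpt1 n g)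
    refine tendsto_nhds_unique h1 ((h2.mono_left hl).congr fun m => ?_)
    exact (hE.inner_simpleIntegral_mul (sA n) (sB m) ξ η η').symm
  have h3 : Tendsto (fun n => ∫ g, ⟪η, (sA n g * U.conjOp B g) η'⟫_ℂ ∂μ) atTop
      (𝓝 (∫ g, ⟪η, U.conjOp (A * B) g η'⟫_ℂ ∂μ)) :=
    tendsto_integral_of_dominated_convergence _
      (fun n => aestronglyMeasurable_of_tendsto_ae atTop (fun m => hmeas n m)
        (Eventually.of_forall fun g => hpt1 n g)) (integrable_const _)
      (fun n => Eventually.of_forall fun g => hbound _ _)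
      (Eventually.of_forall fun g => hpt2 g)
  rw [inner_relativize]
  refine tendsto_nhds_unique ((h3.mono_left hl).congr fun n => (hstep n).symm) ?_
  exact hlimA (pureTensor ξ η) (TB (pureTensor ξ η'))

theorem bornMeasure_map_mul_left (g : G) (ξ : HR) :
    (R.obs.bornMeasure (star (R.rep.op g) ξ)).map (fun h => g * h) = R.obs.bornMeasure ξ := by
  ext X hX
  have hm : Measurable fun h : G => g * h := (continuous_const_mul g).measurable
  rw [Measure.map_apply hm hX, R.obs.bornMeasure_apply _ (hm hX), R.obs.bornMeasure_apply _ hX]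
  have him : (fun x => g * x) '' ((fun h => g * h) ⁻¹' X) = X :=
    Set.image_preimage_eq _ (mul_left_surjective g)
  have hc := R.covariant g _ (hm hX)
  rw [him] at hc
  rw [hc, mul_assoc, mul_apply_eq_comp, mul_apply_eq_comp, ContinuousLinearMap.star_eq_adjoint,
    ContinuousLinearMap.adjoint_inner_left]

/-- Covariance moves `U_R(g)` into a left translation of the Born measure, and the change of
variables `h ↦ g * h` absorbs it into the conjugation on `HS`. -/
theorem relativize_mem_invariantAlgebra (A : HS →L[ℂ] HS) :
    R.relativize U A ∈ invariantAlgebra R.rep U := by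
  rw [mem_invariantAlgebra]
  refine fun g => HilbertTensor.ext_diagonal fun ξ η η' => ?_
  have hm : Measurable fun h : G => g * h := (continuous_const_mul g).measurable
  rw [mul_assoc, mul_apply_eq_comp, ← ContinuousLinearMap.adjoint_inner_left,
    ← ContinuousLinearMap.star_eq_adjoint, mul_apply_eq_comp, ← tensorOp_star,
    tensorOp_pureTensor, tensorOp_pureTensor, inner_relativize, inner_relativize,
    ← R.bornMeasure_map_mul_left g ξ, integral_map hm.aemeasurable
      (U.continuous_inner_conjOp A η η').aestronglyMeasurable]
  refine integral_congr_ae (Eventually.of_forall fun h => ?_)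
  change ⟪_, U.conjOp A h _⟫_ℂ = ⟪η, U.conjOp A (g * h) η'⟫_ℂ
  rw [U.conjOp_mul_right, mul_assoc, mul_apply_eq_comp, mul_apply_eq_comp,
    ContinuousLinearMap.star_eq_adjoint, ContinuousLinearMap.adjoint_inner_left]

/-- The positive elements of the unit ball span a C*-algebra, so the span is already the whole range
of relativization. -/
theorem span_relativize_effects :
    Submodule.span ℂ (R.relativize U '' {F : HS →L[ℂ] HS | 0 ≤ F ∧ F ≤ 1}) =
      (R.relativizeL U).range := by
  have h : Submodule.span ℂ {F : HS →L[ℂ] HS | 0 ≤ F ∧ F ≤ 1} = ⊤ := by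
    rw [eq_top_iff, ← CStarAlgebra.span_nonneg_inter_unitClosedBall]
    refine Submodule.span_mono fun F hF => ⟨hF.1, ?_⟩
    exact (CStarAlgebra.norm_le_one_iff_of_nonneg F hF.1).1 (by simpa using hF.2)
  rw [LinearMap.range_eq_map, ← h, Submodule.map_span]
  rfl

theorem relativize_mem_relativeOperators (A : HS →L[ℂ] HS) :
    R.relativize U A ∈ R.relativeOperators U := by
  let := ultraweakTopology (HilbertTensor HR HS)
  refine subset_closure (SetLike.mem_coe.2 ?_)
  rw [span_relativize_effects]
  exact ⟨A, rfl⟩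

theorem annihilated_of_mem_relativeOperators {T : HilbertTensor HR HS →L[ℂ] HilbertTensor HR HS}
    (hT : T ∈ R.relativeOperators U) (p : SqSummablePair (HilbertTensor HR HS))
    (hp : ∀ A, expectations _ (R.relativize U A) p = 0) : expectations _ T p = 0 := by
  refine annihilated_of_mem_ultraweakClosure hT p fun S hS => ?_
  rw [span_relativize_effects] at hS
  obtain ⟨A, rfl⟩ := hS
  exact hp A

variable [Nontrivial HR] {R}

theorem exists_relativize_eq_of_annihilated (hloc : R.obs.IsLocalizable)
    {T : HilbertTensor HR HS →L[ℂ] HilbertTensor HR HS}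
    (hT : ∀ p : SqSummablePair (HilbertTensor HR HS),
      (∀ A, expectations _ (R.relativize U A) p = 0) → expectations _ T p = 0) :
    ∃ A, R.relativize U A = T :=
  mem_range_of_annihilated (R.relativizeL U) (R.norm_relativize U hloc)
    (R.exists_normal_inner_relativize U) T hT

theorem exists_relativize_eq (hloc : R.obs.IsLocalizable)
    {T : HilbertTensor HR HS →L[ℂ] HilbertTensor HR HS} (hT : T ∈ R.relativeOperators U) :
    ∃ A, R.relativize U A = T :=
  exists_relativize_eq_of_annihilated U hloc (R.annihilated_of_mem_relativeOperators U hT)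

/-- Relativization as an isometric isomorphism onto the space of relative operators. -/
noncomputable def relativizeEquiv (hloc : R.obs.IsLocalizable) :
    (HS →L[ℂ] HS) ≃ₗᵢ[ℂ] R.relativeOperators U :=
  LinearIsometryEquiv.ofSurjective
    { toLinearMap := (R.relativizeL U).codRestrict _ (R.relativize_mem_relativeOperators U)
      norm_map' := R.norm_relativize U hloc }
    fun T => (exists_relativize_eq U hloc T.2).imp fun _ h => Subtype.ext h

theorem coe_relativizeEquiv (hloc : R.obs.IsLocalizable) (A : HS →L[ℂ] HS) :
    (relativizeEquiv U hloc A : HilbertTensor HR HS →L[ℂ] HilbertTensor HR HS) =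
      R.relativize U A := rfl

/-- The relative operators of a localizable sharp frame form a von Neumann algebra. -/
noncomputable def relativeAlgebra (hloc : R.obs.IsLocalizable) (hE : R.obs.IsSharp) :
    VonNeumannAlgebra (HilbertTensor HR HS) :=
  let M : StarSubalgebra ℂ (HilbertTensor HR HS →L[ℂ] HilbertTensor HR HS) :=
    { carrier := R.relativeOperators U
      mul_mem' := fun {S T} hS hT => by
        obtain ⟨A, rfl⟩ := exists_relativize_eq U hloc hS
        obtain ⟨B, rfl⟩ := exists_relativize_eq U hloc hT
        rw [← R.relativize_mul U hE]
        exact R.relativize_mem_relativeOperators U _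
      add_mem' := add_mem
      algebraMap_mem' := fun c => by
        rw [Algebra.algebraMap_eq_smul_one, ← R.relativize_one U]
        exact Submodule.smul_mem _ c (R.relativize_mem_relativeOperators U _)
      star_mem' := fun {T} hT => by
        obtain ⟨A, rfl⟩ := exists_relativize_eq U hloc hT
        rw [← R.relativize_star U]
        exact R.relativize_mem_relativeOperators U _ }
  { toStarSubalgebra := M
    centralizer_centralizer' := by
      refine Set.Subset.antisymm (fun T hT => ?_) Set.subset_centralizer_centralizer
      -- The annihilation criterion applies to the bicommutant directly, so no comparison of
      -- operator topologies is needed.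
      obtain ⟨A, rfl⟩ := exists_relativize_eq_of_annihilated U hloc (T := T) fun p hp =>
        annihilated_of_mem_bicommutant M hT p fun S hS => by
          obtain ⟨A, rfl⟩ := exists_relativize_eq U hloc hS
          exact hp A
      exact R.relativize_mem_relativeOperators U A }

end PrincipalFrame

/-! ### The transported algebra and the conclusion. -/

namespace Transported

variable {M V : Type*} [CStarAlgebra M] [NormedAddCommGroup V] [NormedSpace ℂ V] (e : M ≃ₗᵢ[ℂ] V)

/-- The isometry along which a C*-algebra structure is transported, as a *-isomorphism. -/
noncomputable def starAlgEquiv : M ≃⋆ₐ[ℂ] Transported e where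
  __ := (equiv e).toEquiv
  map_mul' x y := by
    change equiv e (x * y) = equiv e x * equiv e y
    rw [mul_def, LinearIsometryEquiv.symm_apply_apply, LinearIsometryEquiv.symm_apply_apply]
  map_add' x y := map_add (equiv e) x y
  map_star' x := by
    change equiv e (star x) = star (equiv e x)
    rw [star_def, LinearIsometryEquiv.symm_apply_apply]
  map_smul' c x := map_smul (equiv e) c x

theorem isometry_starAlgEquiv : Isometry (starAlgEquiv e) := (equiv e).isometry

end Transported

theorem mainTheorem3
    {G : Type*} [Group G] [TopologicalSpace G] [IsTopologicalGroup G] [LocallyCompactSpace G]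
    [SecondCountableTopology G] [T2Space G] [MeasurableSpace G] [BorelSpace G]
    {HR : Type*} [NormedAddCommGroup HR] [InnerProductSpace ℂ HR] [CompleteSpace HR]
    [TopologicalSpace.SeparableSpace HR] [Nontrivial HR]
    {HS : Type*} [NormedAddCommGroup HS] [InnerProductSpace ℂ HS] [CompleteSpace HS]
    [TopologicalSpace.SeparableSpace HS]
    (R : PrincipalFrame G HR) (U : ProjUnitaryRep G HS) (hloc : R.obs.IsLocalizable) :
    (∀ A T, R.IsWeakIntegral U A T ↔ T = R.relativize U A) ∧
    (∃ Y : (HS →L[ℂ] HS) ≃ₗᵢ[ℂ] R.relativeOperators U,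
      (∀ A, (Y A : HilbertTensor HR HS →L[ℂ] HilbertTensor HR HS) = R.relativize U A) ∧
      (∃ Φ : (HS →L[ℂ] HS) ≃⋆ₐ[ℂ] Transported Y, Isometry Φ ∧ ∀ A, (Φ A).val = Y A) ∧
      (∀ x : Transported Y,
        ((star x).val : HilbertTensor HR HS →L[ℂ] HilbertTensor HR HS) =
          star (x.val : HilbertTensor HR HS →L[ℂ] HilbertTensor HR HS)) ∧
      WStarAlgebra (Transported Y)) ∧
    (R.obs.IsSharp →
      (∀ A B, R.relativize U (A * B) = R.relativize U A * R.relativize U B) ∧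
      ∃ N : VonNeumannAlgebra (HilbertTensor HR HS),
        (N : Set (HilbertTensor HR HS →L[ℂ] HilbertTensor HR HS)) = R.relativeOperators U ∧
        N ≤ invariantAlgebra R.rep U) := by
  refine ⟨R.isWeakIntegral_iff U, ?_, fun hE => ⟨R.relativize_mul U hE,
    PrincipalFrame.relativeAlgebra U hloc hE, rfl, fun T hT => ?_⟩⟩
  · let Y := PrincipalFrame.relativizeEquiv U hloc
    refine ⟨Y, PrincipalFrame.coe_relativizeEquiv U hloc,
      ⟨Transported.starAlgEquiv Y, Transported.isometry_starAlgEquiv Y, fun A => rfl⟩,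
      fun x => ?_, wStarAlgebra_of_linearIsometryEquiv (Transported.equiv Y)⟩
    -- The transported involution is the operator adjoint because relativization commutes with
    -- adjoints.
    obtain ⟨A, rfl⟩ := (Transported.equiv Y).surjective x
    rw [Transported.star_def, LinearIsometryEquiv.symm_apply_apply]
    exact R.relativize_star U A
  · obtain ⟨A, rfl⟩ := PrincipalFrame.exists_relativize_eq U hloc hT
    exact R.relativize_mem_invariantAlgebra U A
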